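/- Let $\Omega\subset\mathbb{R}^3$ be a bounded convex domain with $C^2$ boundary whose Gaussian curvature is positive at every boundary point. Let $\gamma\in[0,1]$ and let $B(r,\theta)$ be a measurable collision cross-section satisfying, for some constant $C_B>0$, the angular cutoff condition $$0\le B(r,\theta)\le C_B\,r^\gamma\cos\theta\sin\theta\qquad\text{for } r\ge 0,\ 0\le\theta\le\tfrac{\pi}{2}.$$ Let $$\nu(v)=\int_{\mathbb{R}^3}\int_0^{2\pi}\int_0^{\pi/2}\pi^{-3/2}e^{-|v_*|^2}\,B(|v-v_*|,\theta)\,d\theta\,d\phi\,dv_*$$ be the associated collision frequency, and assume that $\nu(v)>\nu_0(1+|v|)^\gamma$ for all $v\in\mathbb{R}^3$, with some constant $\nu_0>0$. For $x\in\Omega$ and $v\in\mathbb{R}^3$ let $\tau_-(x,v)=\inf\{t>0:\ x-tv\notin\Omega\}\in(0,\infty]$ be the backward exit time, and let $$(S_\Omega h)(x,v)=\int_0^{\tau_-(x,v)}e^{-\nu(v)s}\,h(x-sv,v)\,ds .$$ For $s\in(0,1)$, write $f\in L^2_v(\mathbb{R}^3;H^s_x(\Omega))$ if $f\in L^2(\Omega\times\mathbb{R}^3)$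 is real-valued and $$\int_{\mathbb{R}^3}\int_\Omega\int_\Omega\frac{|f(x,v)-f(y,v)|^2}{|x-y|^{3+2s}}\,dx\,dy\,dv<\infty .$$ Then for every $\epsilon\in(0,1)$: if $h\in L^2_v(\mathbb{R}^3;H^{1-\epsilon}_x(\Omega))$ and there are constants $a,C>0$ such that $|h(x,v)|\le Ce^{-a|v|^2}$ for almost every $(x,v)\in\Omega\times\mathbb{R}^3$, then $S_\Omega h\in L^2_v(\mathbb{R}^3;H^{1-\epsilon}_x(\Omega))$. -/

import Mathlib

open MeasureTheory Set Filter Topology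
open scoped ENNReal

noncomputable section

namespace Kinetic

/-- Three-dimensional Euclidean space, used both for positions and for velocities. -/
abbrev E3 : Type := EuclideanSpace ℝ (Fin 3)

/-! ### Convex domains of positive curvature -/

/-- `ρ` is a `C²` local defining function of `Ω` near the boundary point `q`: it is `C²` near `q`,
its differential at `q` does not vanish, and `Ω = {ρ < 0}` near `q`. -/
structure IsLocalDefiningFunction (Ω : Set E3) (q : E3) (ρ : E3 → ℝ) : Prop where
  contDiffAt : ContDiffAt ℝ 2 ρ q
  fderiv_ne_zero : fderiv ℝ ρ q ≠ 0
  mem_iff : ∀ᶠ x in 𝓝 q, (x ∈ Ω ↔ ρ x < 0)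

/-- The second fundamental form at `q` of the level surface of `ρ` through `q`
(to be evaluated on vectors tangent to this surface): `D²ρ(q)(u, w) / |∇ρ(q)|`. -/
def secondFundamentalForm (ρ : E3 → ℝ) (q u w : E3) : ℝ :=
  fderiv ℝ (fderiv ℝ ρ) q u w / ‖fderiv ℝ ρ q‖

/-- `(u, w)` is an orthonormal basis of the tangent plane at `q` of the level surface of `ρ`. -/
structure IsTangentFrame (ρ : E3 → ℝ) (q u w : E3) : Prop where
  norm_left : ‖u‖ = 1
  norm_right : ‖w‖ = 1
  inner_eq_zero : inner ℝ u w = 0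
  tangent_left : fderiv ℝ ρ q u = 0
  tangent_right : fderiv ℝ ρ q w = 0

/-- The Gaussian curvature at `q` of the level surface of `ρ` through `q`, computed in the
orthonormal tangent frame `(u, w)`: the determinant of the second fundamental form
(its value does not depend on the frame). -/
def gaussianCurvature (ρ : E3 → ℝ) (q u w : E3) : ℝ :=
  secondFundamentalForm ρ q u u * secondFundamentalForm ρ q w w
    - secondFundamentalForm ρ q u w ^ 2

/-- `Ω` is a bounded convex open set with `C²` boundary of positive Gaussian curvature. -/
structure IsPositivelyCurvedConvexDomain (Ω : Set E3) : Prop where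
  isOpen : IsOpen Ω
  isBounded : Bornology.IsBounded Ω
  convex : Convex ℝ Ω
  curvature_pos : ∀ q ∈ frontier Ω, ∃ ρ : E3 → ℝ, IsLocalDefiningFunction Ω q ρ ∧
    ∀ u w : E3, IsTangentFrame ρ q u w → 0 < gaussianCurvature ρ q u w

/-! ### The collision frequency -/

/-- Grad's angular cutoff assumption on the cross-section `B(r, θ)`, `r = |v - v_*|`:
`0 ≤ B(r, θ) ≤ C r ^ γ cos θ sin θ` for `r ≥ 0` and `0 ≤ θ ≤ π / 2`. -/
structure IsCutoffCrossSection (γ : ℝ) (B : ℝ → ℝ → ℝ) : Prop where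
  measurable : Measurable (fun p : ℝ × ℝ => B p.1 p.2)
  nonneg : ∀ r θ : ℝ, 0 ≤ r → θ ∈ Icc 0 (Real.pi / 2) → 0 ≤ B r θ
  le : ∃ C : ℝ, 0 < C ∧ ∀ r θ : ℝ, 0 ≤ r → θ ∈ Icc 0 (Real.pi / 2) →
    B r θ ≤ C * r ^ γ * Real.cos θ * Real.sin θ

/-- The standard Maxwellian `M(v) = π ^ (-3/2) exp (-|v|²)`. -/
def maxwellian (v : E3) : ℝ :=
  Real.pi ^ (-(3 / 2) : ℝ) * Real.exp (-‖v‖ ^ 2)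

/-- The collision frequency of the linearized collision operator with cross-section `B`, that is
the multiplicative part `ν` of `L f = -ν f + K f`:
`ν(v) = ∫_{ℝ³} ∫_0^{2π} ∫_0^{π/2} M(v_*) B(|v - v_*|, θ) dθ dφ dv_*`. -/
def collisionFrequency (B : ℝ → ℝ → ℝ) (v : E3) : ℝ :=
  ∫ v' : E3, ∫ _φ in (0 : ℝ)..(2 * Real.pi), ∫ θ in (0 : ℝ)..(Real.pi / 2),
    maxwellian v' * B ‖v - v'‖ θ

/-! ### The solution operator of the transport equation -/

/-- The backward exit time `τ₋(x, v) = inf {t > 0 : x - t v ∉ Ω}`, with value `∞` if the backward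
trajectory never leaves `Ω` (which happens for `v = 0`). -/
def exitTime (Ω : Set E3) (x v : E3) : ℝ≥0∞ :=
  ⨅ (t : ℝ) (_ : 0 < t ∧ x - t • v ∉ Ω), ENNReal.ofReal t

/-- The operator `S_Ω` with `(S_Ω h)(x, v) = ∫_0^{τ₋(x, v)} exp (-ν(v) s) h(x - s v, v) ds`.
For `x ∈ Ω` it only uses the values of `h` on `Ω × ℝ³`. -/
def transportSolution (Ω : Set E3) (ν : E3 → ℝ) (h : E3 → E3 → ℝ) (x v : E3) : ℝ :=
  ∫ s in {s : ℝ | 0 < s ∧ ENNReal.ofReal s < exitTime Ω x v},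
    Real.exp (-ν v * s) * h (x - s • v) v

/-! ### The mixed fractional Sobolev space -/

/-- The squared Slobodeckij seminorm of `f` of order `s` in the space variable over `Ω`,
integrated over all velocities:
`∫_{ℝ³} ∫_Ω ∫_Ω |f(x, v) - f(y, v)|² / |x - y| ^ (3 + 2 s) dx dy dv`. -/
def slobodeckijEnergy (Ω : Set E3) (s : ℝ) (f : E3 → E3 → ℝ) : ℝ≥0∞ :=
  ∫⁻ v : E3, ∫⁻ y in Ω, ∫⁻ x in Ω,
    ENNReal.ofReal (|f x v - f y v| ^ 2 / ‖x - y‖ ^ (3 + 2 * s))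

/-- `f ∈ L²_v(ℝ³; H^s_x(Ω))`: `f ∈ L²(Ω × ℝ³)` and the Slobodeckij energy of order `s` is finite.
Only the values of `f` on `Ω × ℝ³` matter. -/
structure MemL2vHsx (Ω : Set E3) (s : ℝ) (f : E3 → E3 → ℝ) : Prop where
  memLp : MemLp (fun p : E3 × E3 => f p.1 p.2) 2 (volume.restrict (Ω ×ˢ univ))
  energy_lt_top : slobodeckijEnergy Ω s f < ∞

end Kinetic

end

open Kinetic

namespace Kinetic

/-! ### Uniform convexity of positively curved domains -/

/-! Modify the source on a null set so that it is measurable, bounded everywhere by `b(v) = C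
exp(-a|v|²)` and zero outside `Ω`; call it `k`. The solution becomes the integral of `exp(-ν s) k(x
- s v, v)` over all `s > 0`, and its values at `x` and `y` are compared at each `s`. While both
backward trajectories are in `Ω`, the weighted Cauchy-Schwarz inequality and the translation
invariance of Lebesgue measure bound the contribution to the energy by `ν⁻²` times the energy of the
source, up to a constant. When only one trajectory is in `Ω`, `s` lies between the two exit times,
so these `s` contribute at most `b(v) |τ(x) - τ(y)|` (`energy_integrand_le`). It remains to bound
the energy of order `1 - ε` of the exit time.

Positive curvature and convexity make the second fundamental form positive definite, hence, by
compactness, `Ω` is uniformly convex with quadratic modulus `κ` (`exists_ball_midpoint_subset`).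
This gives `κ |v|² (τ(x) - τ(y))² ≤ |x - y|`, which alone only reaches orders below `1/2`. Concavity
of `τ` improves it away from the boundary: for `τ(y) ≤ τ(x)`, with `d` the distance to the
complement, `κ |v|² (τ(x) - τ(y))² d(y) ≤ 2 |x - y|²`. Interpolation with exponent `β = 1 - ε`
(`sq_backTime_sub_le_rpow`) and division by `|x - y|^(5 - 2ε)` leave `|x - y|^(ε - 3)` times
`d(x)^(-β) + d(y)^(-β)`. Both singularities are integrable, the second because the boundary layer of
width `t` has volume `O(t)`. The remaining factor `|v|⁻²` is integrable against a Gaussian in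
dimension three. -/

lemma IsLocalDefiningFunction.eq_zero {Ω : Set E3} {q : E3} {ρ : E3 → ℝ}
    (hρ : IsLocalDefiningFunction Ω q ρ) (hΩ : IsOpen Ω) (hq : q ∈ frontier Ω) : ρ q = 0 := by
  have hqn : q ∉ Ω := by
    rw [hΩ.frontier_eq] at hq
    exact hq.2
  apply le_antisymm
  · by_contra! hpos
    have h1 : ∀ᶠ x in 𝓝 q, 0 < ρ x := hρ.contDiffAt.continuousAt.eventually (lt_mem_nhds hpos)
    have h2 : ∃ᶠ x in 𝓝 q, x ∈ Ω := mem_closure_iff_frequently.1 (frontier_subset_closure hq)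
    obtain ⟨x, hx, h3, h4⟩ := (h2.and_eventually (h1.and hρ.mem_iff)).exists
    exact absurd (h4.1 hx) (not_lt.2 h3.le)
  · by_contra! hneg
    exact hqn (hρ.mem_iff.self_of_nhds.2 hneg)

/-- A convex open set lies strictly on the inner side of its tangent planes. -/
lemma IsLocalDefiningFunction.fderiv_sub_neg {Ω : Set E3} {q : E3} {ρ : E3 → ℝ}
    (hρ : IsLocalDefiningFunction Ω q ρ) (hΩ : IsOpen Ω) (hc : Convex ℝ Ω) (hq : q ∈ frontier Ω)
    {x : E3} (hx : x ∈ Ω) : fderiv ℝ ρ q (x - q) < 0 := by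
  have hd : HasFDerivAt ρ (fderiv ℝ ρ q) q :=
    (hρ.contDiffAt.differentiableAt (by norm_num)).hasFDerivAt
  have key : ∀ y ∈ Ω, fderiv ℝ ρ q (y - q) ≤ 0 := by
    intro y hy
    by_contra! hpos
    have h1 : HasDerivAt (fun t : ℝ => ρ (q + t • (y - q))) (fderiv ℝ ρ q (y - q)) 0 := by
      have h2 : HasDerivAt (fun t : ℝ => q + t • (y - q)) (y - q) 0 := by
        simpa using ((hasDerivAt_id (0 : ℝ)).smul_const (y - q)).const_add q
      have h3 : HasFDerivAt ρ (fderiv ℝ ρ q) (q + (0 : ℝ) • (y - q)) := by simpa using hd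
      exact h3.comp_hasDerivAt 0 h2
    have h4 := (hasDerivAt_iff_tendsto_slope.1 h1).eventually (lt_mem_nhds hpos)
    have h5 : ∀ᶠ t : ℝ in 𝓝[>] 0, 0 < slope (fun t : ℝ => ρ (q + t • (y - q))) 0 t :=
      h4.filter_mono (nhdsWithin_mono _ fun t ht => ne_of_gt ht)
    have hcont : Tendsto (fun t : ℝ => q + t • (y - q)) (𝓝 0) (𝓝 q) := by
      have : Continuous (fun t : ℝ => q + t • (y - q)) := by fun_prop
      simpa using this.tendsto 0
    have h6 : ∀ᶠ t : ℝ in 𝓝[>] 0, (q + t • (y - q) ∈ Ω ↔ ρ (q + t • (y - q)) < 0) :=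
      (hcont.eventually hρ.mem_iff).filter_mono nhdsWithin_le_nhds
    have h7 : ∀ᶠ t : ℝ in 𝓝[>] 0, t < 1 :=
      (eventually_lt_nhds one_pos).filter_mono nhdsWithin_le_nhds
    obtain ⟨t, h5, h6, h7, h8⟩ := (h5.and (h6.and (h7.and self_mem_nhdsWithin))).exists
    have h8 : 0 < t := h8
    have hmem : q + t • (y - q) ∈ Ω := by
      have := hc.openSegment_closure_interior_subset_interior (frontier_subset_closure hq)
        (by rwa [hΩ.interior_eq] : y ∈ interior Ω)
      rw [hΩ.interior_eq] at this
      apply this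
      rw [openSegment_eq_image']
      exact ⟨t, ⟨h8, h7⟩, rfl⟩
    have h9 := h6.1 hmem
    rw [slope_def_field] at h5
    simp only [zero_smul, add_zero, hρ.eq_zero hΩ hq, sub_zero] at h5
    exact absurd h5 (not_lt.2 (div_nonpos_of_nonpos_of_nonneg h9.le h8.le))
  refine lt_of_le_of_ne (key x hx) fun h0 => ?_
  -- Equality is impossible because `Ω` is open: a small move from `x` in an ascent direction `e` of
  -- the differential would violate `key`.
  obtain ⟨e, he⟩ : ∃ e, 0 < fderiv ℝ ρ q e := by
    by_contra! hall
    apply hρ.fderiv_ne_zero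
    ext e
    refine le_antisymm (hall e) ?_
    have := hall (-e)
    simp only [map_neg] at this
    simpa using this
  have hcont : Tendsto (fun t : ℝ => x + t • e) (𝓝[>] 0) (𝓝 x) := by
    have : Continuous (fun t : ℝ => x + t • e) := by fun_prop
    have := this.tendsto 0
    simp only [zero_smul, add_zero] at this
    exact this.mono_left nhdsWithin_le_nhds
  obtain ⟨t, ht, h8⟩ := ((hcont.eventually (hΩ.mem_nhds hx)).and self_mem_nhdsWithin).exists
  have := key _ ht
  rw [show x + t • e - q = (x - q) + t • e by abel, map_add, h0, map_smul] at this
  have h8 : 0 < t := h8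
  have : 0 < t * fderiv ℝ ρ q e := by positivity
  simp_all only [smul_eq_mul]
  linarith

/-- The first two derivatives of a function along a line. -/
lemma hasDerivAt_comp_line {ρ : E3 → ℝ} {x d : E3} {t : ℝ}
    (h : DifferentiableAt ℝ ρ (x + t • d)) :
    HasDerivAt (fun t : ℝ => ρ (x + t • d)) (fderiv ℝ ρ (x + t • d) d) t := by
  have h2 : HasDerivAt (fun t : ℝ => x + t • d) d t := by
    simpa using ((hasDerivAt_id t).smul_const d).const_add x
  exact h.hasFDerivAt.comp_hasDerivAt t h2

lemma hasDerivAt_fderiv_comp_line {ρ : E3 → ℝ} {x d : E3} {t : ℝ}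
    (h : DifferentiableAt ℝ (fderiv ℝ ρ) (x + t • d)) :
    HasDerivAt (fun t : ℝ => fderiv ℝ ρ (x + t • d) d)
      (fderiv ℝ (fderiv ℝ ρ) (x + t • d) d d) t := by
  have h2 : HasDerivAt (fun t : ℝ => x + t • d) d t := by
    simpa using ((hasDerivAt_id t).smul_const d).const_add x
  have h3 := h.hasFDerivAt.comp_hasDerivAt t h2
  exact h3.clm_apply (hasDerivAt_const t d) |>.congr_deriv (by simp)

lemma ContDiffAt.eventually_differentiableAt {ρ : E3 → ℝ} {q : E3} (h : ContDiffAt ℝ 2 ρ q) :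
    ∀ᶠ x in 𝓝 q, DifferentiableAt ℝ ρ x ∧ DifferentiableAt ℝ (fderiv ℝ ρ) x := by
  have h1 : ∀ᶠ x in 𝓝 q, ContDiffAt ℝ 2 ρ x := h.eventually (by simp)
  filter_upwards [h1] with x hx
  exact ⟨hx.differentiableAt (by norm_num),
    (hx.fderiv_right (m := 1) (by norm_num)).differentiableAt (by norm_num)⟩

/-- The tangent line `q + t u` misses `Ω`, so `ρ ≥ 0` on it near `q`. A negative second derivative
would make `t = 0` a local maximum, so `ρ` would vanish identically along the line near `q`, and
with it the second derivative. -/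
lemma IsLocalDefiningFunction.hessian_nonneg {Ω : Set E3} {q : E3} {ρ : E3 → ℝ}
    (hρ : IsLocalDefiningFunction Ω q ρ) (hΩ : IsOpen Ω) (hc : Convex ℝ Ω) (hq : q ∈ frontier Ω)
    {u : E3} (hu : fderiv ℝ ρ q u = 0) : 0 ≤ fderiv ℝ (fderiv ℝ ρ) q u u := by
  by_contra! hneg
  have hcont : Tendsto (fun t : ℝ => q + t • u) (𝓝 0) (𝓝 q) := by
    have : Continuous (fun t : ℝ => q + t • u) := by fun_prop
    simpa using this.tendsto 0
  have hdiff := hcont.eventually (ContDiffAt.eventually_differentiableAt hρ.contDiffAt)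
  have hd1 : deriv (fun t : ℝ => ρ (q + t • u)) =ᶠ[𝓝 0] fun t => fderiv ℝ ρ (q + t • u) u :=
    hdiff.mono fun t ht => (hasDerivAt_comp_line ht.1).deriv
  have hd2 : deriv (deriv (fun t : ℝ => ρ (q + t • u))) 0 = fderiv ℝ (fderiv ℝ ρ) q u u := by
    rw [hd1.deriv_eq, (hasDerivAt_fderiv_comp_line hdiff.self_of_nhds.2).deriv]
    simp
  have hmax : IsLocalMax (fun t : ℝ => ρ (q + t • u)) 0 := by
    apply isLocalMax_of_deriv_deriv_neg
    · rw [hd2]; exact hneg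
    · rw [hd1.self_of_nhds]; simpa using hu
    · exact (hasDerivAt_comp_line hdiff.self_of_nhds.1).continuousAt
  have hzero : (fun t : ℝ => ρ (q + t • u)) =ᶠ[𝓝 0] fun _ => 0 := by
    filter_upwards [hmax, hcont.eventually hρ.mem_iff] with t h1 h2
    apply le_antisymm
    · simpa [hρ.eq_zero hΩ hq] using h1
    · by_contra! h3
      have := hρ.fderiv_sub_neg hΩ hc hq (h2.2 h3)
      simp [hu] at this
  have hd3 : deriv (deriv (fun t : ℝ => ρ (q + t • u))) 0 = 0 := by
    rw [hzero.deriv.deriv_eq]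
    simp
  rw [hd2] at hd3
  exact hneg.ne hd3

lemma exists_isTangentFrame {ρ : E3 → ℝ} {q u : E3} (h1 : ‖u‖ = 1) (hu : fderiv ℝ ρ q u = 0) :
    ∃ w, IsTangentFrame ρ q u w := by
  let f : E3 →ₗ[ℝ] ℝ × ℝ := (fderiv ℝ ρ q : E3 →ₗ[ℝ] ℝ).prod (innerSL ℝ u : E3 →ₗ[ℝ] ℝ)
  have hker : LinearMap.ker f ≠ ⊥ := LinearMap.ker_ne_bot_of_finrank_lt (by simp)
  obtain ⟨w, hw, hw0⟩ := (Submodule.ne_bot_iff _).1 hker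
  have hw : fderiv ℝ ρ q w = 0 ∧ inner ℝ u w = 0 := by simpa [f] using hw
  refine ⟨‖w‖⁻¹ • w, h1, ?_, ?_, hu, ?_⟩
  · rw [norm_smul, norm_inv, norm_norm, inv_mul_cancel₀ (norm_ne_zero_iff.2 hw0)]
  · rw [inner_smul_right, hw.2, mul_zero]
  · rw [map_smul, hw.1, smul_zero]

/-- The Hessian is nonnegative on tangent vectors. If it vanished on `u`, then in a frame starting
with `u / ‖u‖` the curvature determinant would reduce to minus the square of the off-diagonal entry.
-/
lemma IsLocalDefiningFunction.hessian_pos {Ω : Set E3} {q : E3} {ρ : E3 → ℝ}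
    (hρ : IsLocalDefiningFunction Ω q ρ) (hΩ : IsOpen Ω) (hc : Convex ℝ Ω) (hq : q ∈ frontier Ω)
    (hcurv : ∀ u w : E3, IsTangentFrame ρ q u w → 0 < gaussianCurvature ρ q u w)
    {u : E3} (hu0 : u ≠ 0) (hu : fderiv ℝ ρ q u = 0) : 0 < fderiv ℝ (fderiv ℝ ρ) q u u := by
  have hn : 0 < ‖u‖ := norm_pos_iff.2 hu0
  refine lt_of_le_of_ne (hρ.hessian_nonneg hΩ hc hq hu) fun h0 => ?_
  have h1 : ‖‖u‖⁻¹ • u‖ = 1 := by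
    rw [norm_smul, norm_inv, norm_norm, inv_mul_cancel₀ hn.ne']
  obtain ⟨w, hw⟩ := exists_isTangentFrame (ρ := ρ) (q := q) h1 (by rw [map_smul, hu, smul_zero])
  have := hcurv _ w hw
  rw [gaussianCurvature, secondFundamentalForm, map_smul, map_smul] at this
  simp only [_root_.smul_apply, ← h0, smul_zero, zero_div, zero_mul, zero_sub] at this
  nlinarith [sq_nonneg (secondFundamentalForm ρ q (‖u‖⁻¹ • u) w)]

/-- A quadratic form that is positive on the kernel of a linear form becomes positive definite
after adding a large multiple of the square of the linear form. -/
lemma exists_penalty {E : Type*} [NormedAddCommGroup E] [NormedSpace ℝ E] [FiniteDimensional ℝ E]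
    (H : E →L[ℝ] E →L[ℝ] ℝ) (L : E →L[ℝ] ℝ) (h : ∀ u, u ≠ 0 → L u = 0 → 0 < H u u) :
    ∃ lam c : ℝ, 0 ≤ lam ∧ 0 < c ∧ ∀ v, c * ‖v‖ ^ 2 ≤ H v v + lam * L v ^ 2 := by
  have hS : IsCompact (Metric.sphere (0 : E) 1) := isCompact_sphere 0 1
  have hcont : ∀ lam : ℝ, Continuous fun v => H v v + lam * L v ^ 2 := fun lam => by fun_prop
  -- The positivity sets increase with `n` and cover the unit sphere: where `L v ≠ 0` a large
  -- multiple wins, and where `L v = 0` the hypothesis applies. Compactness then yields a single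
  -- `n`.
  obtain ⟨n, hn⟩ := hS.elim_directed_cover (fun n : ℕ => {v : E | 0 < H v v + n * L v ^ 2})
    (fun n => isOpen_lt continuous_const (hcont n)) (by
      intro v hv
      have hv0 : v ≠ 0 := by
        rintro rfl
        simp at hv
      simp only [mem_iUnion, mem_ofPred_eq]
      by_cases hL : L v = 0
      · exact ⟨0, by simpa using h v hv0 hL⟩
      · have hL2 : 0 < L v ^ 2 := by positivity
        obtain ⟨n, hn⟩ := exists_nat_gt (-(H v v) / L v ^ 2)
        refine ⟨n, ?_⟩
        rw [div_lt_iff₀ hL2] at hn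
        linarith)
    (directed_of_isDirected_le fun m n hmn v hv => by
      have : (m : ℝ) ≤ n := by exact_mod_cast hmn
      have hv : 0 < H v v + m * L v ^ 2 := hv
      change 0 < H v v + n * L v ^ 2
      nlinarith [sq_nonneg (L v)])
  obtain ⟨c, hc, hc'⟩ : ∃ c : ℝ, 0 < c ∧ ∀ v ∈ Metric.sphere (0 : E) 1,
      c ≤ H v v + n * L v ^ 2 := by
    rcases (Metric.sphere (0 : E) 1).eq_empty_or_nonempty with he | hne
    · exact ⟨1, one_pos, by simp [he]⟩
    · obtain ⟨v, hv, hmin⟩ := hS.exists_isMinOn hne (hcont n).continuousOn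
      exact ⟨_, hn hv, fun w hw => hmin hw⟩
  refine ⟨n, c, by positivity, hc, fun v => ?_⟩
  by_cases hv : v = 0
  · simp [hv]
  have hv' : 0 < ‖v‖ := norm_pos_iff.2 hv
  have := hc' (‖v‖⁻¹ • v) (by simp [norm_smul, hv'.ne'])
  simp only [map_smul, _root_.smul_apply, smul_eq_mul] at this
  have h2 : ‖v‖⁻¹ * (‖v‖⁻¹ * (H v v)) + n * (‖v‖⁻¹ * L v) ^ 2
      = (H v v + n * L v ^ 2) / ‖v‖ ^ 2 := by field_simp
  rw [h2, le_div_iff₀ (by positivity)] at this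
  exact this

/-- Midpoint convexity of `f(t) - m t² / 2`; the gain is `m/4 - m/8 = m/8`. -/
lemma midpoint_le_of_le_second_deriv {f f' f'' : ℝ → ℝ} {m : ℝ}
    (hf : ∀ t ∈ Icc (0 : ℝ) 1, HasDerivAt f (f' t) t)
    (hf' : ∀ t ∈ Icc (0 : ℝ) 1, HasDerivAt f' (f'' t) t)
    (hm : ∀ t ∈ Icc (0 : ℝ) 1, m ≤ f'' t) : f (1 / 2) ≤ (f 0 + f 1) / 2 - m / 8 := by
  have hsq : ∀ t : ℝ, HasDerivAt (fun t : ℝ => m / 2 * t ^ 2) (m * t) t := fun t =>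
    ((hasDerivAt_pow 2 t).const_mul (m / 2)).congr_deriv (by ring)
  have hlin : ∀ t : ℝ, HasDerivAt (fun t : ℝ => m * t) m t := fun t =>
    ((hasDerivAt_id t).const_mul m).congr_deriv (by ring)
  have hconv : ConvexOn ℝ (Icc (0 : ℝ) 1) (fun t => f t - m / 2 * t ^ 2) := by
    apply convexOn_of_hasDerivWithinAt2_nonneg (convex_Icc 0 1)
      (f' := fun t => f' t - m * t) (f'' := fun t => f'' t - m)
    · exact fun t ht => ((hf t ht).sub (hsq t)).continuousAt.continuousWithinAt
    · exact fun t ht => ((hf t (interior_subset ht)).sub (hsq t)).hasDerivWithinAt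
    · exact fun t ht => ((hf' t (interior_subset ht)).sub (hlin t)).hasDerivWithinAt
    · exact fun t ht => sub_nonneg.2 (hm t (interior_subset ht))
  have := hconv.2 (left_mem_Icc.2 zero_le_one) (right_mem_Icc.2 zero_le_one)
    (by norm_num : (0 : ℝ) ≤ 1 / 2) (by norm_num : (0 : ℝ) ≤ 1 / 2) (by norm_num)
  simp only [smul_eq_mul] at this
  norm_num at this ⊢
  linarith

/-- `Ω` is quadratically round at all pairs of points of `Ω` near `p`. -/
def IsRoundNear (Ω : Set E3) (p : E3) : Prop :=
  ∃ r κ : ℝ, 0 < r ∧ 0 < κ ∧ ∀ x ∈ Ω, ∀ y ∈ Ω, x ∈ Metric.ball p r → y ∈ Metric.ball p r →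
    Metric.ball (midpoint ℝ x y) (κ * ‖y - x‖ ^ 2) ⊆ Ω

lemma isRoundNear_of_mem {Ω : Set E3} (hΩ : IsOpen Ω) {p : E3} (hp : p ∈ Ω) :
    IsRoundNear Ω p := by
  obtain ⟨r, hr, hb⟩ := Metric.isOpen_iff.1 hΩ p hp
  refine ⟨r / 2, 1 / (2 * r), by positivity, by positivity, fun x _ y _ hx hy w hw => hb ?_⟩
  have hm := (convex_ball p (r / 2)).midpoint_mem hx hy
  rw [Metric.mem_ball] at *
  have hxy : ‖y - x‖ ≤ r := by
    rw [← dist_eq_norm]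
    linarith [dist_triangle_right y x p]
  have : 1 / (2 * r) * ‖y - x‖ ^ 2 ≤ r / 2 := by
    rw [div_mul_eq_mul_div, one_mul, div_le_div_iff₀ (by positivity) (by positivity)]
    nlinarith [norm_nonneg (y - x)]
  linarith [dist_triangle w (midpoint ℝ x y) p]

/-- The Hessian of `ρ` is only known to be positive on tangent vectors, so `ρ` is replaced by `ψ = ρ
+ (lam/2) ρ²`, which defines the same set near `q` and has positive definite Hessian there. Strong
convexity makes `ψ` quadratically negative at the midpoint, hence `ρ` too, and the Lipschitz bound
for `ρ` turns this depth into a ball. -/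
lemma IsLocalDefiningFunction.isRoundNear {Ω : Set E3} {q : E3} {ρ : E3 → ℝ}
    (hρ : IsLocalDefiningFunction Ω q ρ) (hΩ : IsOpen Ω) (hc : Convex ℝ Ω) (hq : q ∈ frontier Ω)
    (hcurv : ∀ u w : E3, IsTangentFrame ρ q u w → 0 < gaussianCurvature ρ q u w) :
    IsRoundNear Ω q := by
  obtain ⟨lam, c, hlam, hc0, hpen⟩ := exists_penalty (fderiv ℝ (fderiv ℝ ρ) q) (fderiv ℝ ρ q)
    fun u hu0 hu => hρ.hessian_pos hΩ hc hq hcurv hu0 hu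
  have hρq := hρ.eq_zero hΩ hq
  have hC := hρ.contDiffAt
  have hC1 : ContDiffAt ℝ 1 (fderiv ℝ ρ) q := hC.fderiv_right (by norm_num)
  have hC2 : ContinuousAt (fderiv ℝ (fderiv ℝ ρ)) q :=
    (hC1.fderiv_right (m := 0) (by norm_num)).continuousAt
  -- `G x` is the Hessian of `ψ` at `x`; at `q`, where `ρ` vanishes, it is the penalized form from
  -- `hpen`.
  let G : E3 → E3 →L[ℝ] E3 →L[ℝ] ℝ := fun x => (1 + lam * ρ x) • fderiv ℝ (fderiv ℝ ρ) x
    + lam • (fderiv ℝ ρ x).smulRight (fderiv ℝ ρ x)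
  have hG : ∀ x v, G x v v = (1 + lam * ρ x) * fderiv ℝ (fderiv ℝ ρ) x v v
      + lam * fderiv ℝ ρ x v ^ 2 := by
    intro x v
    simp [G, pow_two]
  have hGc : ContinuousAt G q := by
    have h1 := hC.continuousAt
    have h2 := hC1.continuousAt
    have h3 : ContinuousAt (fun x => (fderiv ℝ ρ x).smulRight (fderiv ℝ ρ x)) q := by
      have h4 := (ContinuousLinearMap.smulRightL ℝ E3 (E3 →L[ℝ] ℝ)).continuous.continuousAt.comp
        (x := q) h2
      exact h4.clm_apply h2
    exact ((continuousAt_const.add (continuousAt_const.mul h1)).smul hC2).add (h3.const_smul lam)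
  have e1 : ∀ᶠ x in 𝓝 q, ∀ v, c / 2 * ‖v‖ ^ 2 ≤ G x v v := by
    filter_upwards [(Metric.continuousAt_iff' (f := G)).1 hGc (c / 2) (by positivity)] with x hx v
    have h1 : |(G x - G q) v v| ≤ ‖G x - G q‖ * ‖v‖ * ‖v‖ :=
      (G x - G q).le_opNorm₂ v v
    have h2 : c * ‖v‖ ^ 2 ≤ G q v v := by
      rw [hG, hρq]
      simpa using hpen v
    replace hx : ‖G x - G q‖ < c / 2 := (dist_eq_norm (G x) (G q)).symm.trans_lt hx
    have h3 : ‖G x - G q‖ * ‖v‖ * ‖v‖ ≤ c / 2 * ‖v‖ ^ 2 := by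
      rw [mul_assoc, ← pow_two]
      gcongr
    have h4 := (abs_le.1 h1).1
    simp only [_root_.sub_apply] at h4
    linarith
  -- Since `ψ = ρ (1 + lam ρ / 2)`, positivity of this factor gives `ψ` the sign of `ρ`.
  have e2 : ∀ᶠ x in 𝓝 q, 0 < 1 + lam * ρ x / 2 := by
    have : ContinuousAt (fun x => 1 + lam * ρ x / 2) q :=
      continuousAt_const.add ((continuousAt_const.mul hC.continuousAt).div_const 2)
    exact this.eventually (lt_mem_nhds (by simp [hρq]))
  obtain ⟨K, T, hT, hK⟩ := (hC.of_le (by norm_num : (1 : WithTop ℕ∞) ≤ 2)).exists_lipschitzOnWith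
  have hall := hρ.mem_iff.and (e1.and (e2.and
    ((ContDiffAt.eventually_differentiableAt hC).and (eventually_mem_set.2 hT))))
  obtain ⟨R, hR, hball⟩ := Metric.eventually_nhds_iff_ball.1 hall
  -- The first bound on the radius keeps the Lipschitz variation of `ρ` below the depth `c/16 ‖y -
  -- x‖²`, with `K + 1` avoiding a zero denominator. The second keeps the ball inside `Metric.ball q
  -- R`, because `‖y - x‖ ≤ R`.
  refine ⟨R / 2, min (c / (16 * (K + 1))) (1 / (2 * R)), by positivity, by positivity,
    fun x hx y hy hxr hyr w hw => ?_⟩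
  have hm := (convex_ball q (R / 2)).midpoint_mem hxr hyr
  have hsub : Metric.ball q (R / 2) ⊆ Metric.ball q R := Metric.ball_subset_ball (by linarith)
  have hxy : ‖y - x‖ ≤ R := by
    rw [Metric.mem_ball] at hxr hyr
    rw [← dist_eq_norm]
    linarith [dist_triangle_right y x q]
  rw [Metric.mem_ball] at hw
  have hw1 : dist w (midpoint ℝ x y) < c / (16 * (K + 1)) * ‖y - x‖ ^ 2 :=
    hw.trans_le (by gcongr; exact min_le_left _ _)
  have hw2 : dist w (midpoint ℝ x y) < R / 2 := by
    refine hw.trans_le ((mul_le_mul_of_nonneg_right (min_le_right _ _) (sq_nonneg _)).trans ?_)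
    rw [div_mul_eq_mul_div, one_mul, div_le_div_iff₀ (by positivity) (by positivity)]
    nlinarith [norm_nonneg (y - x)]
  have hwq : w ∈ Metric.ball q R := by
    rw [Metric.mem_ball] at hm ⊢
    linarith [dist_triangle w (midpoint ℝ x y) q]
  have hseg : ∀ t ∈ Icc (0 : ℝ) 1, x + t • (y - x) ∈ Metric.ball q R := by
    intro t ht
    refine hsub ((convex_ball q (R / 2)).segment_subset hxr hyr ?_)
    rw [segment_eq_image']
    exact ⟨t, ht, rfl⟩
  have hmid : x + (1 / 2 : ℝ) • (y - x) = midpoint ℝ x y := by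
    rw [midpoint_eq_smul_add, invOf_eq_inv]
    module
  have hψ := midpoint_le_of_le_second_deriv (m := c / 2 * ‖y - x‖ ^ 2)
    (f := fun t : ℝ => ρ (x + t • (y - x)) + lam / 2 * ρ (x + t • (y - x)) ^ 2)
    (f' := fun t : ℝ => fderiv ℝ ρ (x + t • (y - x)) (y - x)
      + lam * (ρ (x + t • (y - x)) * fderiv ℝ ρ (x + t • (y - x)) (y - x)))
    (f'' := fun t : ℝ => G (x + t • (y - x)) (y - x) (y - x))
    (fun t ht => by
      have h1 := hasDerivAt_comp_line (hball _ (hseg t ht)).2.2.2.1.1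
      refine (h1.add ((h1.pow 2).const_mul (lam / 2))).congr_deriv ?_
      push_cast
      ring)
    (fun t ht => by
      have h1 := hasDerivAt_comp_line (hball _ (hseg t ht)).2.2.2.1.1
      have h2 := hasDerivAt_fderiv_comp_line (hball _ (hseg t ht)).2.2.2.1.2
      refine (h2.add ((h1.mul h2).const_mul lam)).congr_deriv ?_
      rw [hG]
      ring)
    (fun t ht => (hball _ (hseg t ht)).2.1 _)
  rw [hmid] at hψ
  simp only [zero_smul, add_zero, one_smul, add_sub_cancel] at hψ
  have hneg : ∀ z ∈ Ω, z ∈ Metric.ball q R → ρ z + lam / 2 * ρ z ^ 2 < 0 := by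
    intro z hz hzr
    have h1 := (hball z hzr).1.1 hz
    have h2 := (hball z hzr).2.2.1
    have := mul_neg_of_neg_of_pos h1 h2
    linarith
  have hx0 := hneg x hx (hsub hxr)
  have hy0 := hneg y hy (hsub hyr)
  have hρm : ρ (midpoint ℝ x y) ≤ - (c / 16 * ‖y - x‖ ^ 2) := by
    nlinarith [mul_nonneg (by positivity : 0 ≤ lam / 2) (sq_nonneg (ρ (midpoint ℝ x y)))]
  have hlip := hK.dist_le_mul w (hball w hwq).2.2.2.2 _ (hball _ (hsub hm)).2.2.2.2
  rw [(hball w hwq).1]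
  rw [Real.dist_eq] at hlip
  have h5 := (abs_le.1 hlip).2
  have h6 : 0 ≤ dist w (midpoint ℝ x y) := dist_nonneg
  have h7 : (K + 1) * dist w (midpoint ℝ x y) < c / 16 * ‖y - x‖ ^ 2 := by
    calc (K + 1) * dist w (midpoint ℝ x y)
        < (K + 1) * (c / (16 * (K + 1)) * ‖y - x‖ ^ 2) := by gcongr
      _ = c / 16 * ‖y - x‖ ^ 2 := by field_simp
  linarith

/-- A positively curved convex domain is uniformly convex, with quadratic modulus. -/
lemma IsPositivelyCurvedConvexDomain.exists_ball_midpoint_subset {Ω : Set E3}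
    (hΩ : IsPositivelyCurvedConvexDomain Ω) : ∃ κ : ℝ, 0 < κ ∧ ∀ x ∈ Ω, ∀ y ∈ Ω,
      Metric.ball (midpoint ℝ x y) (κ * ‖y - x‖ ^ 2) ⊆ Ω := by
  have hround : ∀ p ∈ closure Ω, IsRoundNear Ω p := by
    intro p hp
    by_cases hpΩ : p ∈ Ω
    · exact isRoundNear_of_mem hΩ.isOpen hpΩ
    · have hpf : p ∈ frontier Ω := by
        rw [hΩ.isOpen.frontier_eq]
        exact ⟨hp, hpΩ⟩
      obtain ⟨ρ, hρ, hcurv⟩ := hΩ.curvature_pos p hpf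
      exact hρ.isRoundNear hΩ.isOpen hΩ.convex hpf hcurv
  obtain ⟨D, hD⟩ := hΩ.isBounded.exists_norm_le
  have hcpt : IsCompact (closure Ω) := hΩ.isBounded.isCompact_closure
  -- Only the midpoint is localized, so that compactness of the closure applies even to pairs of
  -- points that are far apart.
  have key : ∃ κ : ℝ, 0 < κ ∧ ∀ x ∈ Ω, ∀ y ∈ Ω, midpoint ℝ x y ∈ closure Ω →
      Metric.ball (midpoint ℝ x y) (κ * ‖y - x‖ ^ 2) ⊆ Ω := by
    refine hcpt.induction_on (p := fun S => ∃ κ : ℝ, 0 < κ ∧ ∀ x ∈ Ω, ∀ y ∈ Ω,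
      midpoint ℝ x y ∈ S → Metric.ball (midpoint ℝ x y) (κ * ‖y - x‖ ^ 2) ⊆ Ω)
      ⟨1, one_pos, by simp⟩ ?_ ?_ ?_
    · rintro S T hST ⟨κ, hκ, h⟩
      exact ⟨κ, hκ, fun x hx y hy hm => h x hx y hy (hST hm)⟩
    · rintro S T ⟨κ, hκ, h⟩ ⟨κ', hκ', h'⟩
      refine ⟨min κ κ', by positivity, fun x hx y hy hm => ?_⟩
      rcases hm with hm | hm
      · exact (Metric.ball_subset_ball (by gcongr; exact min_le_left _ _)).trans (h x hx y hy hm)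
      · exact (Metric.ball_subset_ball (by gcongr; exact min_le_right _ _)).trans
          (h' x hx y hy hm)
    · intro p hp
      obtain ⟨r, κ, hr, hκ, h⟩ := hround p hp
      -- Contracting `x` and `y` towards their midpoint by the factor `s` keeps the midpoint and
      -- stays in `Ω` by convexity. As the distances are at most `2 |D|`, the contracted points move
      -- within `r/2` of the midpoint, hence into `Metric.ball p r`. The price is the factor `s²` in
      -- the modulus.
      set s : ℝ := r / (4 * (r + |D|)) with hs
      have hs0 : 0 < s := by positivity
      have hs1 : s ≤ 1 := by
        rw [hs, div_le_one (by positivity)]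
        linarith [abs_nonneg D]
      refine ⟨Metric.ball p (r / 2),
        mem_nhdsWithin_of_mem_nhds (Metric.ball_mem_nhds p (by positivity)), κ * s ^ 2, by positivity, fun x hx y hy hm => ?_⟩
      have hmΩ : midpoint ℝ x y ∈ Ω := hΩ.convex.midpoint_mem hx hy
      have hmem : ∀ z ∈ Ω, AffineMap.lineMap (midpoint ℝ x y) z s ∈ Ω := fun z hz =>
        hΩ.convex.segment_subset hmΩ hz (by
          rw [segment_eq_image_lineMap]; exact ⟨s, ⟨hs0.le, hs1⟩, rfl⟩)
      have hdist : ∀ z ∈ Ω, AffineMap.lineMap (midpoint ℝ x y) z s ∈ Metric.ball p r := by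
        intro z hz
        have h1 : dist (AffineMap.lineMap (midpoint ℝ x y) z s) (midpoint ℝ x y) ≤ r / 2 *
            (2 * |D| / (r + |D|) / 2) := by
          rw [dist_lineMap_left, Real.norm_of_nonneg hs0.le, dist_eq_norm]
          have h2 : ‖midpoint ℝ x y - z‖ ≤ 2 * |D| := by
            have := hD _ hmΩ
            have := hD _ hz
            linarith [norm_sub_le (midpoint ℝ x y) z, le_abs_self D]
          calc s * ‖midpoint ℝ x y - z‖ ≤ s * (2 * |D|) := by gcongr
            _ = _ := by rw [hs]; field_simp; ring
        have h3 : 2 * |D| / (r + |D|) / 2 ≤ 1 := by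
          rw [div_div, div_le_one (by positivity)]
          linarith
        rw [Metric.mem_ball] at hm ⊢
        have h4 := dist_triangle (AffineMap.lineMap (midpoint ℝ x y) z s) (midpoint ℝ x y) p
        nlinarith
      have := h _ (hmem x hx) _ (hmem y hy) (hdist x hx) (hdist y hy)
      have e1 : midpoint ℝ (AffineMap.lineMap (midpoint ℝ x y) x s)
          (AffineMap.lineMap (midpoint ℝ x y) y s) = midpoint ℝ x y := by
        simp only [midpoint_eq_smul_add, AffineMap.lineMap_apply_module, invOf_eq_inv]
        module
      have e2 : ‖(AffineMap.lineMap (midpoint ℝ x y) y s : E3)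
          - AffineMap.lineMap (midpoint ℝ x y) x s‖ = s * ‖y - x‖ := by
        rw [show (AffineMap.lineMap (midpoint ℝ x y) y s : E3)
          - AffineMap.lineMap (midpoint ℝ x y) x s = s • (y - x) by
            simp only [AffineMap.lineMap_apply_module]; module, norm_smul,
          Real.norm_of_nonneg hs0.le]
      rw [e1, e2] at this
      rwa [mul_assoc, ← mul_pow]
  obtain ⟨κ, hκ, h⟩ := key
  exact ⟨κ, hκ, fun x hx y hy => h x hx y hy (subset_closure (hΩ.convex.midpoint_mem hx hy))⟩

/-! ### The backward exit time -/

lemma sub_smul_mem_iff_lt_exitTime {Ω : Set E3} (hΩ : IsOpen Ω) (hc : Convex ℝ Ω) {x v : E3}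
    (hx : x ∈ Ω) {s : ℝ} (hs : 0 < s) : x - s • v ∈ Ω ↔ ENNReal.ofReal s < exitTime Ω x v := by
  have hseg : ∀ t t' : ℝ, 0 < t → t ≤ t' → x - t' • v ∈ Ω → x - t • v ∈ Ω := by
    intro t t' ht htt' hmem
    have ht' : 0 < t' := ht.trans_le htt'
    refine hc.segment_subset hx hmem ?_
    rw [segment_eq_image']
    refine ⟨t / t', ⟨by positivity, (div_le_one ht').2 htt'⟩, ?_⟩
    have : t / t' * t' = t := by field_simp
    change x + (t / t') • (x - t' • v - x) = _
    rw [show x - t' • v - x = -(t' • v) by abel, smul_neg, smul_smul, this, sub_eq_add_neg]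
  constructor
  · intro hmem
    have hcont : ContinuousAt (fun t : ℝ => x - t • v) s := by fun_prop
    obtain ⟨t, ht, hst⟩ := (((hcont.eventually (hΩ.mem_nhds hmem)).filter_mono
      nhdsWithin_le_nhds).and (self_mem_nhdsWithin : Ioi s ∈ 𝓝[>] s)).exists
    have hst : s < t := hst
    refine lt_of_lt_of_le ((ENNReal.ofReal_lt_ofReal_iff (hs.trans hst)).2 hst) ?_
    refine le_iInf₂ fun t' ht' => ENNReal.ofReal_le_ofReal ?_
    by_contra! hlt
    exact ht'.2 (hseg t' t ht'.1 hlt.le ht)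
  · intro hlt
    by_contra hmem
    exact absurd hlt (not_lt.2 (iInf₂_le s ⟨hs, hmem⟩))

/-- The backward exit time as a real number. -/
noncomputable def backTime (Ω : Set E3) (v x : E3) : ℝ := (exitTime Ω x v).toReal

lemma sub_smul_mem_iff_lt_backTime {Ω : Set E3} (hΩ : IsOpen Ω) (hc : Convex ℝ Ω)
    (hb : Bornology.IsBounded Ω) {x v : E3} (hv : v ≠ 0) (hx : x ∈ Ω) {s : ℝ} (hs : 0 < s) :
    x - s • v ∈ Ω ↔ s < backTime Ω v x := by
  have hv' : 0 < ‖v‖ := norm_pos_iff.2 hv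
  obtain ⟨D, hD⟩ := hb.exists_norm_le
  have hfin : exitTime Ω x v ≠ ∞ := by
    set t : ℝ := (2 * |D| + 1) / ‖v‖ with ht
    have ht0 : 0 < t := by positivity
    refine ne_top_of_le_ne_top (ENNReal.ofReal_ne_top (r := t)) (iInf₂_le t ⟨ht0, fun hmem => ?_⟩)
    have h1 := hD _ hmem
    have h2 := hD _ hx
    have h3 : ‖t • v‖ = 2 * |D| + 1 := by
      rw [norm_smul, Real.norm_of_nonneg ht0.le, ht]
      field_simp
    have h4 : ‖t • v‖ ≤ ‖x‖ + ‖x - t • v‖ := by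
      simpa using norm_sub_le x (x - t • v)
    linarith [le_abs_self D]
  rw [sub_smul_mem_iff_lt_exitTime hΩ hc hx hs, backTime, ENNReal.ofReal_lt_iff_lt_toReal hs.le hfin]

lemma backTime_pos {Ω : Set E3} (hΩ : IsOpen Ω) (hc : Convex ℝ Ω)
    (hb : Bornology.IsBounded Ω) {x v : E3} (hv : v ≠ 0) (hx : x ∈ Ω) : 0 < backTime Ω v x := by
  have hcont : ContinuousAt (fun t : ℝ => x - t • v) 0 := by fun_prop
  have hmem : ∀ᶠ t : ℝ in 𝓝 0, x - t • v ∈ Ω :=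
    hcont.eventually (hΩ.mem_nhds (by simpa using hx))
  obtain ⟨t, ht, ht0⟩ := ((hmem.filter_mono nhdsWithin_le_nhds).and
    (self_mem_nhdsWithin : Ioi (0 : ℝ) ∈ 𝓝[>] 0)).exists
  have ht0 : 0 < t := ht0
  exact ht0.trans ((sub_smul_mem_iff_lt_backTime hΩ hc hb hv hx ht0).1 ht)

/-- Convex combinations of points reached from `x` and `y` before their exits stay in `Ω`. If
concavity failed, scaling both exit times by `θ < 1` would put the exit point of `a • x + b • y`
itself into `Ω`, which is open. -/
lemma concaveOn_backTime {Ω : Set E3} (hΩ : IsOpen Ω) (hc : Convex ℝ Ω)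
    (hb : Bornology.IsBounded Ω) {v : E3} (hv : v ≠ 0) : ConcaveOn ℝ Ω (backTime Ω v) := by
  refine ⟨hc, fun x hx y hy a b ha hb' hab => ?_⟩
  have hz : a • x + b • y ∈ Ω := hc hx hy ha hb' hab
  have hzp := backTime_pos hΩ hc hb hv hz
  have hxp := backTime_pos hΩ hc hb hv hx
  have hyp := backTime_pos hΩ hc hb hv hy
  by_contra! hlt
  simp only [smul_eq_mul] at hlt
  set M := a * backTime Ω v x + b * backTime Ω v y with hM
  have hMp : 0 < M := hzp.trans hlt
  set θ := backTime Ω v (a • x + b • y) / M with hθ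
  have hθ0 : 0 < θ := by positivity
  have hθ1 : θ < 1 := (div_lt_one hMp).2 hlt
  have h1 := (sub_smul_mem_iff_lt_backTime hΩ hc hb hv hx (s := θ * backTime Ω v x)
    (by positivity)).2 (by nlinarith)
  have h2 := (sub_smul_mem_iff_lt_backTime hΩ hc hb hv hy (s := θ * backTime Ω v y)
    (by positivity)).2 (by nlinarith)
  have h3 := hc h1 h2 ha hb' hab
  have h4 : θ * M = backTime Ω v (a • x + b • y) := by rw [hθ]; field_simp
  have h5 : a • (x - (θ * backTime Ω v x) • v) + b • (y - (θ * backTime Ω v y) • v)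
      = a • x + b • y - (θ * M) • v := by
    rw [hM]; module
  rw [h5, h4, sub_smul_mem_iff_lt_backTime hΩ hc hb hv hz hzp] at h3
  exact lt_irrefl _ h3

/-- On a uniformly convex domain the exit time is Hölder continuous of order `1 / 2`. -/
lemma sq_backTime_sub_le_norm {Ω : Set E3} (hΩ : IsOpen Ω) (hc : Convex ℝ Ω)
    (hb : Bornology.IsBounded Ω) {κ : ℝ} (hround : ∀ x ∈ Ω, ∀ y ∈ Ω,
      Metric.ball (midpoint ℝ x y) (κ * ‖y - x‖ ^ 2) ⊆ Ω)
    {x y v : E3} (hv : v ≠ 0) (hx : x ∈ Ω) (hy : y ∈ Ω) :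
    κ * ‖v‖ ^ 2 * (backTime Ω v x - backTime Ω v y) ^ 2 ≤ ‖x - y‖ := by
  wlog hlt : backTime Ω v y < backTime Ω v x generalizing x y
  · rcases (not_lt.1 hlt).eq_or_lt with h | h
    · rw [h]; simp
    · have := this hy hx h
      rwa [norm_sub_rev, ← neg_sub (backTime Ω v x), neg_sq] at this
  have hyp := backTime_pos hΩ hc hb hv hy
  set s := backTime Ω v y with hs
  -- The points of the trajectory from `x` at times `s` and `s'` are in `Ω`, so a ball around their
  -- midpoint is too. Were `‖x - y‖` smaller than its radius, translation by `y - x` would show that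
  -- the trajectory from `y` is still in `Ω` at time `(s + s') / 2`, after its exit.
  have key : ∀ s' ∈ Ioo s (backTime Ω v x), κ * ‖v‖ ^ 2 * (s' - s) ^ 2 ≤ ‖x - y‖ := by
    intro s' hs'
    have h1 := (sub_smul_mem_iff_lt_backTime hΩ hc hb hv hx (hyp.trans hs'.1)).2 hs'.2
    have h2 := (sub_smul_mem_iff_lt_backTime hΩ hc hb hv hx hyp).2 hlt
    have h3 := hround _ h2 _ h1
    by_contra! hcon
    have h4 : y - ((s + s') / 2) • v ∈ Ω := by
      apply h3
      rw [Metric.mem_ball, dist_eq_norm]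
      have e1 : y - ((s + s') / 2) • v - midpoint ℝ (x - s • v) (x - s' • v) = y - x := by
        rw [midpoint_eq_smul_add, invOf_eq_inv]; module
      have e2 : ‖x - s' • v - (x - s • v)‖ ^ 2 = ‖v‖ ^ 2 * (s' - s) ^ 2 := by
        rw [show x - s' • v - (x - s • v) = -((s' - s) • v) by module, norm_neg, norm_smul,
          mul_pow, Real.norm_eq_abs, sq_abs, mul_comm]
      rw [e1, e2, norm_sub_rev, ← mul_assoc]
      exact hcon
    have hs1 := hs'.1
    have h5 := (sub_smul_mem_iff_lt_backTime hΩ hc hb hv hy (by linarith)).1 h4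
    linarith
  have hcl : IsClosed {s' : ℝ | κ * ‖v‖ ^ 2 * (s' - s) ^ 2 ≤ ‖x - y‖} :=
    isClosed_le (by fun_prop) continuous_const
  have := closure_minimal key hcl
  rw [closure_Ioo hlt.ne] at this
  exact this (right_mem_Icc.2 hlt.le)

/-- Prolong the segment from `x` to `y` beyond `y` by half the distance `d` of `y` to the
complement. By concavity, the drop of the exit time on the prolongation is at least `t` times the
drop from `x` to `y`, where `t = d / (2 ‖x - y‖)`. The Hölder bound on the prolongation then gains a
factor of order `‖x - y‖ / d`. -/
lemma sq_backTime_sub_mul_infDist_le {Ω : Set E3} (hΩ : IsOpen Ω) (hc : Convex ℝ Ω)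
    (hb : Bornology.IsBounded Ω) {κ : ℝ} (hκ : 0 < κ) (hround : ∀ x ∈ Ω, ∀ y ∈ Ω,
      Metric.ball (midpoint ℝ x y) (κ * ‖y - x‖ ^ 2) ⊆ Ω)
    {x y v : E3} (hv : v ≠ 0) (hx : x ∈ Ω) (hy : y ∈ Ω)
    (hle : backTime Ω v y ≤ backTime Ω v x) :
    κ * ‖v‖ ^ 2 * (backTime Ω v x - backTime Ω v y) ^ 2 * Metric.infDist y Ωᶜ
      ≤ 2 * ‖x - y‖ ^ 2 := by
  rcases eq_or_ne x y with rfl | hxy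
  · simp
  rcases (Metric.infDist_nonneg (x := y) (s := Ωᶜ)).eq_or_lt with h0 | hd
  · rw [← h0, mul_zero]; positivity
  have hz : 0 < ‖x - y‖ := norm_pos_iff.2 (sub_ne_zero.2 hxy)
  set d := Metric.infDist y Ωᶜ with hd'
  obtain ⟨t, ht⟩ : ∃ t, t = d / (2 * ‖x - y‖) := ⟨_, rfl⟩
  have ht0 : 0 < t := by rw [ht]; positivity
  have htz : t * ‖x - y‖ = d / 2 := by rw [ht]; field_simp
  have hy' : y - t • (x - y) ∈ Ω := by
    by_contra hmem
    have := Metric.infDist_le_dist_of_mem (x := y) (show y - t • (x - y) ∈ Ωᶜ from hmem)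
    rw [dist_eq_norm, sub_sub_cancel, norm_smul, Real.norm_of_nonneg ht0.le, htz] at this
    linarith
  have h1 := (concaveOn_backTime hΩ hc hb hv).2 hx hy' (by positivity : 0 ≤ t / (1 + t))
    (by positivity : 0 ≤ 1 / (1 + t)) (by field_simp; ring)
  have e1 : (t / (1 + t)) • x + (1 / (1 + t)) • (y - t • (x - y)) = y := by
    match_scalars <;> field_simp <;> ring
  rw [e1] at h1
  simp only [smul_eq_mul] at h1
  have h2 : t * (backTime Ω v x - backTime Ω v y)
      ≤ backTime Ω v y - backTime Ω v (y - t • (x - y)) := by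
    rw [div_mul_eq_mul_div, div_mul_eq_mul_div, ← add_div, div_le_iff₀ (by positivity)] at h1
    linarith
  have h3 := sq_backTime_sub_le_norm hΩ hc hb hround hv hy hy'
  rw [sub_sub_cancel, norm_smul, Real.norm_of_nonneg ht0.le] at h3
  have h4 : (t * (backTime Ω v x - backTime Ω v y)) ^ 2
      ≤ (backTime Ω v y - backTime Ω v (y - t • (x - y))) ^ 2 :=
    pow_le_pow_left₀ (mul_nonneg ht0.le (sub_nonneg.2 hle)) h2 2
  have h5 : κ * ‖v‖ ^ 2 * (t * (backTime Ω v x - backTime Ω v y)) ^ 2 ≤ t * ‖x - y‖ :=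
    (mul_le_mul_of_nonneg_left h4 (by positivity)).trans h3
  have h6 : κ * ‖v‖ ^ 2 * (backTime Ω v x - backTime Ω v y) ^ 2 * t ≤ ‖x - y‖ := by
    have : t * (κ * ‖v‖ ^ 2 * (backTime Ω v x - backTime Ω v y) ^ 2 * t) ≤ t * ‖x - y‖ := by
      linarith
    exact le_of_mul_le_mul_left this ht0
  have h7 : d = 2 * ‖x - y‖ * t := by rw [ht]; field_simp
  rw [h7]
  nlinarith

/-- Interpolation of the two bounds for the variation of the exit time. -/
lemma sq_backTime_sub_le_rpow {Ω : Set E3} (hΩ : IsOpen Ω) (hc : Convex ℝ Ω)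
    (hb : Bornology.IsBounded Ω) {κ : ℝ} (hκ : 0 < κ) (hround : ∀ x ∈ Ω, ∀ y ∈ Ω,
      Metric.ball (midpoint ℝ x y) (κ * ‖y - x‖ ^ 2) ⊆ Ω)
    {β : ℝ} (hβ0 : 0 < β) (hβ1 : β < 1) {x y v : E3} (hv : v ≠ 0) (hx : x ∈ Ω) (hy : y ∈ Ω) :
    κ * ‖v‖ ^ 2 * (backTime Ω v x - backTime Ω v y) ^ 2 ≤ 2 * ‖x - y‖ ^ (1 + β)
      * (Metric.infDist x Ωᶜ ^ (-β) + Metric.infDist y Ωᶜ ^ (-β)) := by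
  wlog hle : backTime Ω v y ≤ backTime Ω v x generalizing x y
  · have := this hy hx (le_of_not_ge hle)
    rw [norm_sub_rev, add_comm (Metric.infDist y Ωᶜ ^ (-β)), ← neg_sub (backTime Ω v x),
      neg_sq] at this
    exact this
  have hne : Ωᶜ.Nonempty := by
    rw [nonempty_compl]
    rintro rfl
    exact NormedSpace.unbounded_univ ℝ E3 hb
  have hd : 0 < Metric.infDist y Ωᶜ :=
    (hΩ.isClosed_compl.notMem_iff_infDist_pos hne).1 (not_not.2 hy)
  have h1 := sq_backTime_sub_le_norm hΩ hc hb hround hv hx hy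
  have h2 := sq_backTime_sub_mul_infDist_le hΩ hc hb hκ hround hv hx hy hle
  set A := κ * ‖v‖ ^ 2 * (backTime Ω v x - backTime Ω v y) ^ 2 with hA
  have hA0 : 0 ≤ A := by positivity
  set Z := ‖x - y‖
  have hZ0 : 0 ≤ Z := norm_nonneg _
  set d := Metric.infDist y Ωᶜ
  have h3 : A ≤ 2 * Z ^ 2 * d⁻¹ := by
    rw [← div_eq_mul_inv, le_div_iff₀ hd]; exact h2
  have hx0 : 0 ≤ Metric.infDist x Ωᶜ ^ (-β) := Real.rpow_nonneg Metric.infDist_nonneg _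
  have hy0 : 0 ≤ d ^ (-β) := Real.rpow_nonneg hd.le _
  -- The Hölder bound is used on the power `1 - β`, the bound weighted by the distance on the power
  -- `β`.
  calc A = A ^ (1 - β) * A ^ β := by
        rw [← Real.rpow_add_of_nonneg hA0 (by linarith) hβ0.le]; simp
    _ ≤ Z ^ (1 - β) * (2 * Z ^ 2 * d⁻¹) ^ β := by
        gcongr
    _ = 2 ^ β * Z ^ (1 + β) * d ^ (-β) := by
        rw [Real.mul_rpow (by positivity) (by positivity), Real.mul_rpow (by norm_num)
          (by positivity), Real.inv_rpow hd.le, Real.rpow_neg hd.le,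
          show (1 + β) = (1 - β) + 2 * β by ring, Real.rpow_add_of_nonneg hZ0 (by linarith)
          (by linarith), Real.rpow_mul hZ0]
        norm_num
        ring_nf
    _ ≤ 2 * Z ^ (1 + β) * d ^ (-β) := by
        gcongr
        calc (2 : ℝ) ^ β ≤ 2 ^ (1 : ℝ) := Real.rpow_le_rpow_of_exponent_le (by norm_num) hβ1.le
          _ = 2 := Real.rpow_one 2
    _ ≤ _ := by
        gcongr
        linarith

/-! ### Integrability of singular weights -/

/-- The inner tubular neighbourhood of width `t` of the boundary of a bounded convex open set has
volume `O(t)`. -/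
lemma exists_volume_infDist_lt_le {Ω : Set E3} (hΩ : IsOpen Ω) (hc : Convex ℝ Ω)
    (hb : Bornology.IsBounded Ω) : ∃ C : ℝ, 0 ≤ C ∧ ∀ t : ℝ, 0 < t →
      volume {x ∈ Ω | Metric.infDist x Ωᶜ < t} ≤ ENNReal.ofReal (C * t) := by
  rcases Ω.eq_empty_or_nonempty with rfl | ⟨x₀, hx₀⟩
  · exact ⟨0, le_rfl, by simp⟩
  obtain ⟨r, hr, hball⟩ := Metric.isOpen_iff.1 hΩ x₀ hx₀
  have hfin : volume Ω ≠ ∞ := hb.measure_lt_top.ne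
  have hne : Ωᶜ.Nonempty := by
    rw [nonempty_compl]
    rintro rfl
    exact NormedSpace.unbounded_univ ℝ E3 hb
  set V := (volume Ω).toReal with hV
  have hV0 : 0 ≤ V := ENNReal.toReal_nonneg
  have hVe : volume Ω = ENNReal.ofReal V := (ENNReal.ofReal_toReal hfin).symm
  refine ⟨3 * V / r, by positivity, fun t ht => ?_⟩
  rcases le_or_gt r t with hrt | htr
  · refine (measure_mono (sep_subset _ _)).trans ?_
    rw [hVe]
    apply ENNReal.ofReal_le_ofReal
    rw [div_mul_eq_mul_div, le_div_iff₀ hr]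
    nlinarith
  set θ := t / r with hθ
  have hθ0 : 0 < θ := by positivity
  have hθ1 : θ < 1 := (div_lt_one hr).2 htr
  set f := AffineMap.homothety x₀ (1 - θ) with hf
  have hfx : ∀ x, f x = (1 - θ) • x + θ • x₀ := fun x => by
    rw [hf, AffineMap.homothety_apply, vsub_eq_sub, vadd_eq_add]; module
  have hsub : f '' Ω ⊆ Ω := by
    rintro _ ⟨x, hx, rfl⟩
    rw [hfx]
    exact hc hx hx₀ (by linarith) hθ0.le (by ring)
  have hopen : IsOpen (f '' Ω) := by
    exact AffineMap.homothety_isOpenMap x₀ (1 - θ) (by linarith) Ω hΩ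
  -- A point of the contracted copy of `Ω` is `(1 - θ) x + θ x₀`; varying `x₀` over the ball of
  -- radius `r` shows that a ball of radius `θ r = t` around it lies in `Ω`. So the boundary layer
  -- avoids the copy, and its volume is at most `(1 - (1 - θ)³) |Ω|`.
  have hincl : {x ∈ Ω | Metric.infDist x Ωᶜ < t} ⊆ Ω \ f '' Ω := by
    rintro y ⟨hy, hyt⟩
    refine ⟨hy, ?_⟩
    rintro ⟨x, hx, rfl⟩
    obtain ⟨w, hw, hwt⟩ := (Metric.infDist_lt_iff hne).1 hyt
    apply hw
    have hmem : x₀ + θ⁻¹ • (w - f x) ∈ Ω := by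
      apply hball
      rw [Metric.mem_ball, dist_eq_norm, add_sub_cancel_left, norm_smul, norm_inv,
        Real.norm_of_nonneg hθ0.le, inv_mul_lt_iff₀ hθ0, ← dist_eq_norm, dist_comm]
      refine hwt.trans_eq ?_
      rw [hθ]; field_simp
    have := hc hx hmem (a := 1 - θ) (b := θ) (by linarith) hθ0.le (by ring)
    rwa [smul_add, smul_smul, mul_inv_cancel₀ hθ0.ne', one_smul, ← add_assoc, ← hfx,
      add_sub_cancel] at this
  refine (measure_mono hincl).trans ?_
  rw [measure_sdiff hsub hopen.measurableSet.nullMeasurableSet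
    (ne_top_of_le_ne_top hfin (measure_mono hsub)), hf, Measure.addHaar_image_homothety, hVe,
    ← ENNReal.ofReal_mul (abs_nonneg _), ← ENNReal.ofReal_sub _ (by positivity)]
  apply ENNReal.ofReal_le_ofReal
  rw [finrank_euclideanSpace_fin, abs_of_nonneg (pow_nonneg (by linarith) 3)]
  have e : 3 * V / r * t = 3 * V * θ := by rw [hθ]; ring
  rw [e]
  have : V * (1 - (1 - θ) ^ 3) ≤ V * (3 * θ) := by
    apply mul_le_mul_of_nonneg_left _ hV0
    nlinarith [pow_pos hθ0 2, pow_pos hθ0 3]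
  linarith

/-- Layer-cake formula for the reciprocal distance: levels `t ≤ 1` cost at most the volume of `Ω`
against `t^(β - 1)`, and levels `t > 1` cost `O(1/t)` by the boundary-layer estimate, leaving `t^(β
- 2)`. -/
lemma lintegral_infDist_rpow_neg_lt_top {Ω : Set E3} (hΩ : IsOpen Ω) (hc : Convex ℝ Ω)
    (hb : Bornology.IsBounded Ω) {β : ℝ} (hβ0 : 0 < β) (hβ1 : β < 1) :
    ∫⁻ x in Ω, ENNReal.ofReal (Metric.infDist x Ωᶜ ^ (-β)) < ∞ := by
  obtain ⟨C, hC0, hC⟩ := exists_volume_infDist_lt_le hΩ hc hb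
  have hfin : volume Ω < ∞ := hb.measure_lt_top
  have hmeas : Measurable fun x : E3 => (Metric.infDist x Ωᶜ)⁻¹ :=
    (Metric.continuous_infDist_pt _).measurable.inv
  have h0 : ∀ x : E3, Metric.infDist x Ωᶜ ^ (-β) = (Metric.infDist x Ωᶜ)⁻¹ ^ β := fun x => by
    rw [Real.inv_rpow Metric.infDist_nonneg, Real.rpow_neg Metric.infDist_nonneg]
  simp_rw [h0]
  rw [lintegral_rpow_eq_lintegral_meas_lt_mul _
    (ae_of_all _ fun x => inv_nonneg.2 Metric.infDist_nonneg) hmeas.aemeasurable hβ0]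
  refine ENNReal.mul_lt_top ENNReal.ofReal_lt_top ?_
  rw [← Ioc_union_Ioi_eq_Ioi (zero_le_one' ℝ)]
  refine (lintegral_union_le _ _ _).trans_lt (ENNReal.add_lt_top.2 ⟨?_, ?_⟩)
  · calc ∫⁻ t in Ioc (0 : ℝ) 1, (volume.restrict Ω) {a | t < (Metric.infDist a Ωᶜ)⁻¹}
          * ENNReal.ofReal (t ^ (β - 1))
        ≤ ∫⁻ t in Ioc (0 : ℝ) 1, volume Ω * ENNReal.ofReal (t ^ (β - 1)) := by
          refine lintegral_mono fun t => mul_le_mul_left ?_ _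
          calc (volume.restrict Ω) {a | t < (Metric.infDist a Ωᶜ)⁻¹}
              ≤ (volume.restrict Ω) univ := measure_mono (subset_univ _)
            _ = volume Ω := Measure.restrict_apply_univ Ω
      _ = volume Ω * ∫⁻ t in Ioc (0 : ℝ) 1, ENNReal.ofReal (t ^ (β - 1)) :=
          lintegral_const_mul' _ _ hfin.ne
      _ < ∞ := by
          refine ENNReal.mul_lt_top hfin ?_
          have := (intervalIntegral.intervalIntegrable_rpow' (a := 0) (b := 1)
            (by linarith : -1 < β - 1))
          rw [intervalIntegrable_iff_integrableOn_Ioc_of_le zero_le_one] at this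
          exact this.lintegral_lt_top
  · calc ∫⁻ t in Ioi (1 : ℝ), (volume.restrict Ω) {a | t < (Metric.infDist a Ωᶜ)⁻¹}
          * ENNReal.ofReal (t ^ (β - 1))
        ≤ ∫⁻ t in Ioi (1 : ℝ), ENNReal.ofReal (C * t ^ (β - 2)) := by
          refine setLIntegral_mono' measurableSet_Ioi fun t ht => ?_
          have ht0 : 0 < t := one_pos.trans ht
          have h1 : (volume.restrict Ω) {a | t < (Metric.infDist a Ωᶜ)⁻¹}
              ≤ ENNReal.ofReal (C * t⁻¹) := by
            rw [Measure.restrict_apply (measurableSet_lt measurable_const hmeas)]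
            refine (measure_mono ?_).trans (hC t⁻¹ (by positivity))
            rintro x ⟨hx, hxΩ⟩
            have hx : t < (Metric.infDist x Ωᶜ)⁻¹ := hx
            have hpos : 0 < Metric.infDist x Ωᶜ := inv_pos.1 (ht0.trans hx)
            exact ⟨hxΩ, (lt_inv_comm₀ ht0 hpos).1 hx⟩
          refine (mul_le_mul_left h1 _).trans ?_
          rw [← ENNReal.ofReal_mul (by positivity)]
          apply ENNReal.ofReal_le_ofReal
          rw [mul_assoc, ← Real.rpow_neg_one, ← Real.rpow_add ht0]
          exact le_of_eq (by ring_nf)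
      _ < ∞ := ((integrableOn_Ioi_rpow_of_lt (by linarith : β - 2 < -1) one_pos).const_mul
          C).lintegral_lt_top

lemma exists_lintegral_norm_sub_rpow_le {Ω : Set E3} (hb : Bornology.IsBounded Ω) {ε : ℝ}
    (hε : 0 < ε) : ∃ J : ℝ≥0∞, J < ∞ ∧ ∀ y ∈ Ω,
      ∫⁻ x in Ω, ENNReal.ofReal (‖x - y‖ ^ (ε - 3)) ≤ J := by
  obtain ⟨D, hD⟩ := hb.exists_norm_le
  refine ⟨∫⁻ z in Metric.ball (0 : E3) (2 * D + 1), ENNReal.ofReal (‖z‖ ^ (ε - 3)), ?_, ?_⟩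
  · have : IntegrableOn (fun z : E3 => ‖z‖ ^ (ε - 3)) (Metric.ball 0 (2 * D + 1)) := by
      refine integrableOn_ball_of_norm_le_rpow (C := 1) (α := 3 - ε) (by simp) ?_ ?_ ?_
      · rw [finrank_euclideanSpace_fin]; push_cast; linarith
      · refine ae_of_all _ fun x => ?_
        rw [Real.norm_of_nonneg (by positivity), one_mul, neg_sub]
      · exact (Measurable.aestronglyMeasurable (by fun_prop))
    exact this.lintegral_lt_top
  · intro y hy
    have hmp := measurePreserving_sub_right (volume : Measure E3) y
    have hpre := hmp.setLIntegral_comp_emb (measurableEmbedding_subRight y)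
      (fun z : E3 => ENNReal.ofReal (‖z‖ ^ (ε - 3))) Ω
    rw [hpre]
    apply lintegral_mono_set
    rintro _ ⟨x, hx, rfl⟩
    rw [mem_ball_zero_iff]
    have h1 := hD x hx
    have h2 := hD y hy
    have := norm_sub_le x y
    simp only
    linarith

/-- In polar coordinates the Jacobian `r²` cancels the singularity. -/
lemma lintegral_exp_div_sq_norm_lt_top {a : ℝ} (ha : 0 < a) :
    ∫⁻ v : E3, ENNReal.ofReal (Real.exp (-a * ‖v‖ ^ 2) / ‖v‖ ^ 2) < ∞ := by
  have : Integrable (fun v : E3 => Real.exp (-a * ‖v‖ ^ 2) / ‖v‖ ^ 2) := by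
    rw [integrable_fun_norm_addHaar (volume : Measure E3)
      (f := fun r : ℝ => Real.exp (-a * r ^ 2) / r ^ 2)]
    refine (integrable_exp_neg_mul_sq ha).integrableOn.congr_fun (fun r hr => ?_) measurableSet_Ioi
    have hr : (r : ℝ) ≠ 0 := ne_of_gt hr
    simp only [finrank_euclideanSpace_fin, Nat.add_one_sub_one, smul_eq_mul]
    field_simp
  exact this.lintegral_lt_top

lemma lintegral_exp_sq_norm_lt_top {a : ℝ} (ha : 0 < a) :
    ∫⁻ v : E3, ENNReal.ofReal (Real.exp (-a * ‖v‖ ^ 2)) < ∞ := by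
  have : Integrable (fun v : E3 => Real.exp (-a * ‖v‖ ^ 2)) := by
    rw [integrable_fun_norm_addHaar (volume : Measure E3)
      (f := fun r : ℝ => Real.exp (-a * r ^ 2))]
    refine (integrable_rpow_mul_exp_neg_mul_sq ha (s := 2) (by norm_num)).integrableOn.congr_fun
      (fun r hr => ?_) measurableSet_Ioi
    simp
  exact this.lintegral_lt_top

/-! ### Reduction to a bounded measurable source -/

lemma measurePreserving_shear (s : ℝ) :
    MeasurePreserving (fun p : E3 × E3 => (p.1 - s • p.2, p.2)) volume volume := by
  have h : MeasurePreserving (fun p : E3 × E3 => (p.1, p.2 - s • p.1))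
      ((volume : Measure E3).prod volume) ((volume : Measure E3).prod volume) :=
    MeasurePreserving.skew_product (g := fun v x : E3 => x - s • v)
      (MeasurePreserving.id (volume : Measure E3)) (by fun_prop)
      (ae_of_all _ fun v => (measurePreserving_sub_right volume (s • v)).map_eq)
  exact (Measure.measurePreserving_swap.comp h).comp Measure.measurePreserving_swap

/-- For each fixed `s` the shear `(x, v) ↦ (x - s v, v)` preserves measure, so it pulls the
exceptional null set back to a null set. Exchanging the quantifiers by Fubini, almost every
trajectory meets this set only for a null set of times. -/
lemma transportSolution_congr_ae {Ω : Set E3} (hΩ : IsOpen Ω) (hc : Convex ℝ Ω) (ν : E3 → ℝ)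
    {h h' : E3 → E3 → ℝ} (hae : ∀ᵐ p : E3 × E3 ∂(volume.restrict (Ω ×ˢ univ)),
      h p.1 p.2 = h' p.1 p.2) :
    ∀ᵐ p : E3 × E3 ∂(volume.restrict (Ω ×ˢ univ)),
      transportSolution Ω ν h p.1 p.2 = transportSolution Ω ν h' p.1 p.2 := by
  have hms : MeasurableSet (Ω ×ˢ (univ : Set E3)) := hΩ.measurableSet.prod MeasurableSet.univ
  rw [ae_restrict_iff' hms] at hae ⊢
  obtain ⟨M, hNM, hM, hM0⟩ := exists_measurable_superset_of_null (ae_iff.1 hae)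
  have h1 : ∀ᵐ s : ℝ, ∀ᵐ p : E3 × E3, (p.1 - s • p.2, p.2) ∉ M := ae_of_all _ fun s =>
    (measurePreserving_shear s).quasiMeasurePreserving.ae (measure_eq_zero_iff_ae_notMem.1 hM0)
  have hmeas : MeasurableSet {q : ℝ × (E3 × E3) | (q.2.1 - q.1 • q.2.2, q.2.2) ∉ M} := by
    have : Measurable fun q : ℝ × (E3 × E3) => (q.2.1 - q.1 • q.2.2, q.2.2) := by fun_prop
    exact this hM.compl
  rw [Measure.ae_ae_comm hmeas] at h1
  filter_upwards [h1] with p hp hpΩ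
  have hS : MeasurableSet {s : ℝ | 0 < s ∧ ENNReal.ofReal s < exitTime Ω p.1 p.2} :=
    measurableSet_Ioi.inter (ENNReal.measurable_ofReal measurableSet_Iio)
  refine setIntegral_congr_ae hS ?_
  filter_upwards [hp] with s hs hsS
  have hmem := (sub_smul_mem_iff_lt_exitTime hΩ hc hpΩ.1 hsS.1).2 hsS.2
  by_cases heq : h (p.1 - s • p.2) p.2 = h' (p.1 - s • p.2) p.2
  · rw [heq]
  · refine absurd (hNM ?_) hs
    simp only [mem_ofPred_eq, Classical.not_imp]
    exact ⟨⟨hmem, mem_univ _⟩, heq⟩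

lemma slobodeckijEnergy_congr_ae {Ω : Set E3} (s : ℝ) {f g : E3 → E3 → ℝ}
    (hae : ∀ᵐ p : E3 × E3 ∂(volume.restrict (Ω ×ˢ univ)), f p.1 p.2 = g p.1 p.2) :
    slobodeckijEnergy Ω s f = slobodeckijEnergy Ω s g := by
  rw [Measure.volume_eq_prod, ← Measure.prod_restrict, Measure.restrict_univ] at hae
  have h1 : ∀ᵐ p : E3 × E3 ∂((volume : Measure E3).prod (volume.restrict Ω)),
      f p.2 p.1 = g p.2 p.1 :=
    (Measure.measurePreserving_swap (μ := (volume : Measure E3))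
      (ν := (volume.restrict Ω))).quasiMeasurePreserving.ae hae
  refine lintegral_congr_ae ?_
  filter_upwards [Measure.ae_ae_of_ae_prod h1] with v hv
  refine lintegral_congr_ae ?_
  filter_upwards [hv] with y hy
  refine lintegral_congr_ae ?_
  filter_upwards [hv] with x hx
  rw [hx, hy]

/-- A source with Gaussian decay almost everywhere agrees almost everywhere with a measurable one
that decays everywhere and vanishes outside of `Ω`. -/
lemma exists_measurable_source {Ω : Set E3} (hΩ : IsOpen Ω) {h : E3 → E3 → ℝ}
    (hm : AEStronglyMeasurable (fun p : E3 × E3 => h p.1 p.2) (volume.restrict (Ω ×ˢ univ)))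
    {b : E3 → ℝ} (hb : Measurable b) (hb0 : ∀ v, 0 ≤ b v)
    (hbound : ∀ᵐ p : E3 × E3 ∂(volume.restrict (Ω ×ˢ univ)), |h p.1 p.2| ≤ b p.2) :
    ∃ k : E3 → E3 → ℝ, Measurable (fun p : E3 × E3 => k p.1 p.2) ∧ (∀ x v, |k x v| ≤ b v) ∧
      (∀ x v, x ∉ Ω → k x v = 0) ∧
      ∀ᵐ p : E3 × E3 ∂(volume.restrict (Ω ×ˢ univ)), h p.1 p.2 = k p.1 p.2 := by
  classical
  have hms : MeasurableSet (Ω ×ˢ (univ : Set E3)) := hΩ.measurableSet.prod MeasurableSet.univ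
  set g := hm.mk _ with hg
  have hgm : Measurable g := hm.stronglyMeasurable_mk.measurable
  have hset : MeasurableSet {p : E3 × E3 | p.1 ∈ Ω ∧ |g p| ≤ b p.2} :=
    (measurable_fst hΩ.measurableSet).inter
      (measurableSet_le hgm.abs (hb.comp measurable_snd))
  refine ⟨fun x v => if x ∈ Ω ∧ |g (x, v)| ≤ b v then g (x, v) else 0,
    Measurable.ite hset hgm measurable_const, fun x v => ?_, fun x v hx => ?_, ?_⟩
  · dsimp only
    split_ifs with hif
    · exact hif.2
    · simpa using hb0 v
  · exact if_neg fun hif => hx hif.1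
  · filter_upwards [hm.ae_eq_mk, hbound, ae_restrict_mem hms] with p h1 h2 h3
    rw [if_pos]
    · exact h1
    · refine ⟨h3.1, ?_⟩
      have h1 : h p.1 p.2 = g (p.1, p.2) := h1
      rwa [← h1]

/-- For a source vanishing outside of `Ω`, the solution operator integrates over the whole
half-line. -/
lemma transportSolution_eq_integral_Ioi {Ω : Set E3} (hΩ : IsOpen Ω) (hc : Convex ℝ Ω)
    (ν : E3 → ℝ) {k : E3 → E3 → ℝ} (hk : ∀ x v, x ∉ Ω → k x v = 0) {x : E3} (hx : x ∈ Ω)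
    (v : E3) : transportSolution Ω ν k x v
      = ∫ s in Ioi (0 : ℝ), Real.exp (-ν v * s) * k (x - s • v) v := by
  refine (setIntegral_eq_of_subset_of_forall_sdiff_eq_zero measurableSet_Ioi
    (fun s hs => hs.1) ?_).symm
  rintro s ⟨hs, hs'⟩
  rw [hk, mul_zero]
  exact fun hmem => hs' ⟨hs, (sub_smul_mem_iff_lt_exitTime hΩ hc hx hs).1 hmem⟩

lemma measurable_collisionFrequency {B : ℝ → ℝ → ℝ}
    (hB : Measurable (fun p : ℝ × ℝ => B p.1 p.2)) : Measurable (collisionFrequency B) := by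
  have h1 : Measurable fun q : (E3 × E3) × ℝ => maxwellian q.1.2 * B ‖q.1.1 - q.1.2‖ q.2 := by
    have h2 : Measurable fun q : (E3 × E3) × ℝ => B ‖q.1.1 - q.1.2‖ q.2 :=
      hB.comp (f := fun q : (E3 × E3) × ℝ => (‖q.1.1 - q.1.2‖, q.2)) (by fun_prop)
    have h3 : Measurable maxwellian := by
      unfold maxwellian
      fun_prop
    exact (h3.comp (by fun_prop)).mul h2
  have h4 : StronglyMeasurable fun p : E3 × E3 => ∫ θ in (0 : ℝ)..(Real.pi / 2),
      maxwellian p.2 * B ‖p.1 - p.2‖ θ := by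
    simp only [intervalIntegral.integral_of_le (by positivity : (0 : ℝ) ≤ Real.pi / 2)]
    exact h1.stronglyMeasurable.integral_prod_right
  unfold collisionFrequency
  simp only [intervalIntegral.integral_const]
  have h5 : StronglyMeasurable (Function.uncurry fun v v' : E3 => (2 * Real.pi - 0) •
      ∫ θ in (0 : ℝ)..(Real.pi / 2), maxwellian v' * B ‖v - v'‖ θ) :=
    h4.const_smul (2 * Real.pi - 0)
  exact h5.integral_prod_right.measurable

lemma measurable_integral_Ioi {ν : E3 → ℝ} (hν : Measurable ν) {k : E3 → E3 → ℝ}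
    (hk : Measurable (fun p : E3 × E3 => k p.1 p.2)) :
    Measurable fun p : E3 × E3 =>
      ∫ s in Ioi (0 : ℝ), Real.exp (-ν p.2 * s) * k (p.1 - s • p.2) p.2 := by
  have h1 : Measurable fun q : (E3 × E3) × ℝ =>
      Real.exp (-ν q.1.2 * q.2) * k (q.1.1 - q.2 • q.1.2) q.1.2 := by
    have h2 : Measurable fun q : (E3 × E3) × ℝ => k (q.1.1 - q.2 • q.1.2) q.1.2 :=
      hk.comp (f := fun q : (E3 × E3) × ℝ => (q.1.1 - q.2 • q.1.2, q.1.2)) (by fun_prop)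
    have h3 : Measurable fun q : (E3 × E3) × ℝ => ν q.1.2 := hν.comp (by fun_prop)
    exact (Real.measurable_exp.comp (h3.neg.mul measurable_snd)).mul h2
  exact h1.stronglyMeasurable.integral_prod_right.measurable

lemma integral_Ioi_exp_neg_mul {n : ℝ} (hn : 0 < n) :
    IntegrableOn (fun s : ℝ => Real.exp (-n * s)) (Ioi 0) ∧
      ∫ s in Ioi (0 : ℝ), Real.exp (-n * s) = 1 / n := by
  refine ⟨integrableOn_exp_mul_Ioi (by linarith) 0, ?_⟩
  rw [integral_exp_mul_Ioi (by linarith)]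
  simp

lemma lintegral_Ioi_exp_neg_mul {n : ℝ} (hn : 0 < n) :
    ∫⁻ s in Ioi (0 : ℝ), ENNReal.ofReal (Real.exp (-n * s)) = ENNReal.ofReal (1 / n) := by
  rw [← (integral_Ioi_exp_neg_mul hn).2, ofReal_integral_eq_lintegral_ofReal
    (integral_Ioi_exp_neg_mul hn).1 (ae_of_all _ fun s => (Real.exp_pos _).le)]

lemma abs_integral_Ioi_le {n b : ℝ} (hn : 0 < n) {k : ℝ → ℝ} (hk : ∀ s, |k s| ≤ b) :
    |∫ s in Ioi (0 : ℝ), Real.exp (-n * s) * k s| ≤ b / n := by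
  have h1 := norm_integral_le_of_norm_le ((integral_Ioi_exp_neg_mul hn).1.mul_const b)
    (f := fun s : ℝ => Real.exp (-n * s) * k s) (ae_of_all _ fun s => by
      rw [Real.norm_eq_abs, abs_mul, abs_of_pos (Real.exp_pos _)]
      exact mul_le_mul_of_nonneg_left (hk s) (Real.exp_pos _).le)
  rw [integral_mul_const, (integral_Ioi_exp_neg_mul hn).2] at h1
  rw [div_eq_mul_one_div, mul_comm b]
  exact h1

/-! ### The energy estimate at a fixed velocity -/

/-- Cauchy-Schwarz for the splitting `w g = w^(1/2) · (w^(1/2) g)`. -/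
lemma sq_lintegral_mul_le {α : Type*} [MeasurableSpace α] (μ : Measure α) {w g : α → ℝ≥0∞}
    (hw : AEMeasurable w μ) (hg : AEMeasurable g μ) :
    (∫⁻ a, w a * g a ∂μ) ^ 2 ≤ (∫⁻ a, w a ∂μ) * ∫⁻ a, w a * g a ^ 2 ∂μ := by
  have h := ENNReal.lintegral_mul_le_Lp_mul_Lq μ Real.HolderConjugate.two_two
    (hw.pow_const (1 / 2 : ℝ)) ((hw.pow_const (1 / 2 : ℝ)).mul hg)
  have e1 : ∀ a, w a ^ (1 / 2 : ℝ) * w a ^ (1 / 2 : ℝ) = w a := fun a => by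
    rw [← ENNReal.rpow_add_of_nonneg _ _ (by norm_num) (by norm_num)]
    norm_num
  have e2 : ∀ a, (w a ^ (1 / 2 : ℝ)) ^ 2 = w a := fun a => by rw [pow_two, e1]
  simp only [Pi.mul_apply, ← mul_assoc, e1, ENNReal.rpow_two, mul_pow, e2] at h
  have e3 : ∀ c : ℝ≥0∞, (c ^ (1 / 2 : ℝ)) ^ 2 = c := fun c => by
    rw [← ENNReal.rpow_two, ← ENNReal.rpow_mul]
    norm_num
  calc (∫⁻ a, w a * g a ∂μ) ^ 2
      ≤ ((∫⁻ a, w a ∂μ) ^ (1 / 2 : ℝ) * (∫⁻ a, w a * g a ^ 2 ∂μ) ^ (1 / 2 : ℝ)) ^ 2 := by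
        gcongr
    _ = _ := by rw [mul_pow, e3, e3]

lemma ENNReal.add_sq_le_two_mul (a b : ℝ≥0∞) : (a + b) ^ 2 ≤ 2 * (a ^ 2 + b ^ 2) := by
  have := ENNReal.rpow_add_le_mul_rpow_add_rpow a b (p := 2) (by norm_num)
  norm_num at this
  exact this

/-- The integrand of the Slobodeckij energy, extended by zero outside of `Ω × Ω`. -/
noncomputable def energyKernel (Ω : Set E3) (p : ℝ) (k : E3 → ℝ) : E3 × E3 → ℝ≥0∞ :=
  (Ω ×ˢ Ω).indicator fun q => ENNReal.ofReal (|k q.1 - k q.2| ^ 2 / ‖q.1 - q.2‖ ^ p)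

lemma measurable_energyKernel {Ω : Set E3} (hΩ : MeasurableSet Ω) (p : ℝ) {k : E3 → ℝ}
    (hk : Measurable k) : Measurable (energyKernel Ω p k) := by
  refine Measurable.indicator ?_ (hΩ.prod hΩ)
  fun_prop

lemma lintegral_energyKernel {Ω : Set E3} (hΩ : MeasurableSet Ω) (p : ℝ) {k : E3 → ℝ}
    (hk : Measurable k) : ∫⁻ q, energyKernel Ω p k q
      = ∫⁻ y in Ω, ∫⁻ x in Ω, ENNReal.ofReal (|k x - k y| ^ 2 / ‖x - y‖ ^ p) := by
  rw [energyKernel, lintegral_indicator (hΩ.prod hΩ), Measure.volume_eq_prod,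
    ← Measure.prod_restrict, lintegral_prod_symm' _ (by fun_prop)]

lemma measurable_mul_energyKernel_translate {Ω : Set E3} (hΩ : MeasurableSet Ω) (p : ℝ)
    {k : E3 → ℝ} (hk : Measurable k) (n : ℝ) (v : E3) : Measurable fun z : (E3 × E3) × ℝ =>
      ENNReal.ofReal (Real.exp (-n * z.2))
        * energyKernel Ω p k (z.1.1 - z.2 • v, z.1.2 - z.2 • v) :=
  Measurable.mul (by fun_prop) ((measurable_energyKernel hΩ p hk).comp
    (f := fun z : (E3 × E3) × ℝ => (z.1.1 - z.2 • v, z.1.2 - z.2 • v)) (by fun_prop))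

/-- Measurability is required of one summand only, so the exit-time term can be split off without
proving it jointly measurable. -/
lemma lintegral_lintegral_add_left {Ω : Set E3} {f : E3 × E3 → ℝ≥0∞} (hf : Measurable f)
    (g : E3 → E3 → ℝ≥0∞) : ∫⁻ y in Ω, ∫⁻ x in Ω, (f (x, y) + g x y)
      = (∫⁻ y in Ω, ∫⁻ x in Ω, f (x, y)) + ∫⁻ y in Ω, ∫⁻ x in Ω, g x y := by
  have h1 : ∀ y, Measurable fun x => f (x, y) := fun y => hf.comp (by fun_prop)
  simp_rw [lintegral_add_left (h1 _)]
  exact lintegral_add_left hf.lintegral_prod_left' _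

/-- Averaging over translations does not increase the energy. -/
lemma lintegral_lintegral_energyKernel_translate_le {Ω : Set E3} (hΩ : MeasurableSet Ω) (p : ℝ)
    {k : E3 → ℝ} (hk : Measurable k) {n : ℝ} (hn : 0 < n) (v : E3) :
    ∫⁻ y in Ω, ∫⁻ x in Ω, ∫⁻ s in Ioi (0 : ℝ), ENNReal.ofReal (Real.exp (-n * s))
        * energyKernel Ω p k (x - s • v, y - s • v)
      ≤ ENNReal.ofReal (1 / n) * ∫⁻ q, energyKernel Ω p k q := by
  have hG := measurable_mul_energyKernel_translate hΩ p hk n v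
  calc ∫⁻ y in Ω, ∫⁻ x in Ω, ∫⁻ s in Ioi (0 : ℝ), ENNReal.ofReal (Real.exp (-n * s))
        * energyKernel Ω p k (x - s • v, y - s • v)
      ≤ ∫⁻ y, ∫⁻ x, ∫⁻ s in Ioi (0 : ℝ), ENNReal.ofReal (Real.exp (-n * s))
        * energyKernel Ω p k (x - s • v, y - s • v) :=
        (setLIntegral_le_lintegral _ _).trans
          (lintegral_mono fun y => setLIntegral_le_lintegral _ _)
    _ = ∫⁻ q : E3 × E3, ∫⁻ s in Ioi (0 : ℝ), ENNReal.ofReal (Real.exp (-n * s))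
        * energyKernel Ω p k (q.1 - s • v, q.2 - s • v) := by
        rw [Measure.volume_eq_prod, lintegral_prod_symm' _ hG.lintegral_prod_right]
    _ = ∫⁻ s in Ioi (0 : ℝ), ∫⁻ q : E3 × E3, ENNReal.ofReal (Real.exp (-n * s))
        * energyKernel Ω p k (q.1 - s • v, q.2 - s • v) :=
        lintegral_lintegral_swap hG.aemeasurable
    _ = ∫⁻ s in Ioi (0 : ℝ), ENNReal.ofReal (Real.exp (-n * s))
        * ∫⁻ q : E3 × E3, energyKernel Ω p k q := by
        refine lintegral_congr fun s => ?_
        rw [lintegral_const_mul' _ _ ENNReal.ofReal_ne_top]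
        congr 1
        have : (volume : Measure (E3 × E3)).IsAddRightInvariant := by
          rw [Measure.volume_eq_prod]
          infer_instance
        exact lintegral_sub_right_eq_self (μ := (volume : Measure (E3 × E3)))
          (energyKernel Ω p k) (s • v, s • v)
    _ = _ := by
        rw [lintegral_mul_const _ (by fun_prop), lintegral_Ioi_exp_neg_mul hn]

/-- The difference of two solutions is controlled by the differences of the sources along the two
trajectories and by the difference of the exit times. -/
lemma energy_integrand_le {Ω : Set E3} (hΩ : IsOpen Ω) (hc : Convex ℝ Ω)
    (hbd : Bornology.IsBounded Ω) {k : E3 → ℝ} (hk : Measurable k) {b : ℝ}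
    (hkb : ∀ x, |k x| ≤ b) (hk0 : ∀ x, x ∉ Ω → k x = 0) {n : ℝ} (hn : 0 < n) (p : ℝ)
    {v : E3} (hv : v ≠ 0) {x y : E3} (hx : x ∈ Ω) (hy : y ∈ Ω) :
    ENNReal.ofReal (|(∫ s in Ioi (0 : ℝ), Real.exp (-n * s) * k (x - s • v))
        - ∫ s in Ioi (0 : ℝ), Real.exp (-n * s) * k (y - s • v)| ^ 2 / ‖x - y‖ ^ p)
      ≤ 2 * (ENNReal.ofReal (1 / n) * ∫⁻ s in Ioi (0 : ℝ), ENNReal.ofReal (Real.exp (-n * s))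
          * energyKernel Ω p k (x - s • v, y - s • v))
        + 2 * ENNReal.ofReal
          (b ^ 2 * (backTime Ω v x - backTime Ω v y) ^ 2 / ‖x - y‖ ^ p) := by
  have hb0 : 0 ≤ b := (abs_nonneg _).trans (hkb x)
  have hint : ∀ z : E3, IntegrableOn (fun s : ℝ => Real.exp (-n * s) * k (z - s • v)) (Ioi 0) := by
    intro z
    refine (integral_Ioi_exp_neg_mul hn).1.mul_bdd (c := b) ?_ (ae_of_all _ fun s => hkb _)
    exact (hk.comp (by fun_prop)).aestronglyMeasurable
  set A : Set ℝ := {s | x - s • v ∈ Ω ∧ y - s • v ∈ Ω} with hA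
  have hAm : MeasurableSet A := by
    have h1 : Measurable fun s : ℝ => x - s • v := by fun_prop
    have h2 : Measurable fun s : ℝ => y - s • v := by fun_prop
    exact (h1 hΩ.measurableSet).inter (h2 hΩ.measurableSet)
  set g : ℝ → ℝ≥0∞ := A.indicator fun s => ENNReal.ofReal |k (x - s • v) - k (y - s • v)| with hg
  have hgm : Measurable g := by
    refine Measurable.indicator ?_ hAm
    have h1 : Measurable fun s : ℝ => k (x - s • v) := hk.comp (by fun_prop)
    have h2 : Measurable fun s : ℝ => k (y - s • v) := hk.comp (by fun_prop)
    exact (h1.sub h2).abs.ennreal_ofReal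
  set J : Set ℝ := uIcc (backTime Ω v x) (backTime Ω v y) with hJ
  set I1 := ∫⁻ s in Ioi (0 : ℝ), ENNReal.ofReal (Real.exp (-n * s)) * g s with hI1
  set Δ := backTime Ω v x - backTime Ω v y with hΔ
  have hdiff : ENNReal.ofReal |(∫ s in Ioi (0 : ℝ), Real.exp (-n * s) * k (x - s • v))
      - ∫ s in Ioi (0 : ℝ), Real.exp (-n * s) * k (y - s • v)|
      ≤ I1 + ENNReal.ofReal (b * |Δ|) := by
    rw [← integral_sub (hint x) (hint y), ← Real.enorm_eq_ofReal_abs]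
    refine (enorm_integral_le_lintegral_enorm _).trans ?_
    have hpt : ∀ s ∈ Ioi (0 : ℝ), ‖Real.exp (-n * s) * k (x - s • v)
        - Real.exp (-n * s) * k (y - s • v)‖ₑ
        ≤ ENNReal.ofReal (Real.exp (-n * s)) * g s + J.indicator (fun _ => ENNReal.ofReal b) s := by
      intro s hs
      have hs : 0 < s := hs
      rw [← mul_sub, Real.enorm_eq_ofReal_abs, abs_mul, abs_of_pos (Real.exp_pos _),
        ENNReal.ofReal_mul (Real.exp_pos _).le]
      by_cases hsA : s ∈ A
      · rw [hg, indicator_of_mem hsA]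
        exact le_self_add
      -- Now at most one of the two points lies in `Ω`. If exactly one does, `s` lies in the
      -- interval `J` between the exit times and the integrand is at most `b`; otherwise it
      -- vanishes.
      have hxs := sub_smul_mem_iff_lt_backTime hΩ hc hbd hv hx hs
      have hys := sub_smul_mem_iff_lt_backTime hΩ hc hbd hv hy hs
      rw [hg, indicator_of_notMem hsA, mul_zero, zero_add]
      have hexp : Real.exp (-n * s) ≤ 1 := Real.exp_le_one_iff.2 (by nlinarith)
      have hle : ∀ c : ℝ, c ≤ b → ENNReal.ofReal (Real.exp (-n * s)) * ENNReal.ofReal c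
          ≤ ENNReal.ofReal b := by
        intro c hcb
        calc ENNReal.ofReal (Real.exp (-n * s)) * ENNReal.ofReal c
            ≤ 1 * ENNReal.ofReal b := by
              gcongr
              exact ENNReal.ofReal_le_one.2 hexp
          _ = _ := one_mul _
      by_cases h1 : x - s • v ∈ Ω
      · have h2 : y - s • v ∉ Ω := fun h2 => hsA ⟨h1, h2⟩
        rw [indicator_of_mem (mem_uIcc.2 (Or.inr ⟨not_lt.1 (mt hys.2 h2), (hxs.1 h1).le⟩)),
          hk0 _ h2, sub_zero]
        exact hle _ (hkb _)
      · by_cases h2 : y - s • v ∈ Ω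
        · rw [indicator_of_mem (mem_uIcc.2 (Or.inl ⟨not_lt.1 (mt hxs.2 h1), (hys.1 h2).le⟩)),
            hk0 _ h1, zero_sub, abs_neg]
          exact hle _ (hkb _)
        · rw [hk0 _ h1, hk0 _ h2]
          simp
    refine (setLIntegral_mono' measurableSet_Ioi hpt).trans ?_
    rw [lintegral_add_left (by fun_prop)]
    gcongr
    refine (setLIntegral_le_lintegral _ _).trans ?_
    rw [lintegral_indicator_const measurableSet_uIcc, Real.volume_interval,
      ENNReal.ofReal_mul hb0, hΔ, abs_sub_comm]
  set c := ENNReal.ofReal ((‖x - y‖ ^ p)⁻¹) with hcdef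
  have hker : ∀ s, g s ^ 2 * c = energyKernel Ω p k (x - s • v, y - s • v) := by
    intro s
    by_cases hs : s ∈ A
    · rw [hg, indicator_of_mem hs, energyKernel, indicator_of_mem (show _ ∈ Ω ×ˢ Ω from hs),
        ← ENNReal.ofReal_pow (abs_nonneg _), hcdef, ← ENNReal.ofReal_mul (by positivity),
        sub_sub_sub_cancel_right, div_eq_mul_inv]
    · rw [hg, indicator_of_notMem hs, energyKernel, indicator_of_notMem (show _ ∉ Ω ×ˢ Ω from hs)]
      simp
  have hcs : I1 ^ 2 * c ≤ ENNReal.ofReal (1 / n) * ∫⁻ s in Ioi (0 : ℝ),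
      ENNReal.ofReal (Real.exp (-n * s)) * energyKernel Ω p k (x - s • v, y - s • v) := by
    have h1 := sq_lintegral_mul_le (volume.restrict (Ioi (0 : ℝ)))
      (w := fun s => ENNReal.ofReal (Real.exp (-n * s))) (by fun_prop) hgm.aemeasurable
    rw [lintegral_Ioi_exp_neg_mul hn] at h1
    refine (mul_le_mul_left h1 c).trans_eq ?_
    rw [mul_assoc, ← lintegral_mul_const' _ _ ENNReal.ofReal_ne_top]
    refine congrArg _ (lintegral_congr fun s => ?_)
    rw [mul_assoc, hker]
  rw [div_eq_mul_inv, ENNReal.ofReal_mul (by positivity), ENNReal.ofReal_pow (abs_nonneg _)]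
  calc _ ≤ (I1 + ENNReal.ofReal (b * |Δ|)) ^ 2 * c := by gcongr
    _ ≤ 2 * (I1 ^ 2 + ENNReal.ofReal (b * |Δ|) ^ 2) * c := by
        gcongr
        exact ENNReal.add_sq_le_two_mul _ _
    _ = 2 * (I1 ^ 2 * c) + 2 * (ENNReal.ofReal (b * |Δ|) ^ 2 * c) := by ring
    _ ≤ _ := by
        gcongr
        rw [hcdef, ← ENNReal.ofReal_pow (by positivity), ← ENNReal.ofReal_mul (by positivity),
          mul_pow, sq_abs, ← div_eq_mul_inv]

/-! ### The energy of the exit time and the main theorem -/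

lemma lintegral_singular_weights_lt_top {Ω : Set E3} (hΩ : IsOpen Ω) (hc : Convex ℝ Ω)
    (hb : Bornology.IsBounded Ω) {ε β : ℝ} (hε : 0 < ε) (hβ0 : 0 < β) (hβ1 : β < 1) :
    ∫⁻ y in Ω, ∫⁻ x in Ω, (ENNReal.ofReal (‖x - y‖ ^ (ε - 3))
        * ENNReal.ofReal (Metric.infDist x Ωᶜ ^ (-β)) + ENNReal.ofReal (‖x - y‖ ^ (ε - 3))
        * ENNReal.ofReal (Metric.infDist y Ωᶜ ^ (-β))) < ∞ := by
  obtain ⟨J, hJ, hJle⟩ := exists_lintegral_norm_sub_rpow_le hb hε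
  have hI := lintegral_infDist_rpow_neg_lt_top hΩ hc hb hβ0 hβ1
  have hmd : Measurable fun x : E3 => Metric.infDist x Ωᶜ := Metric.continuous_infDist_pt _ |>.measurable
  have h2 : ∫⁻ y in Ω, ∫⁻ x in Ω, ENNReal.ofReal (‖x - y‖ ^ (ε - 3))
      * ENNReal.ofReal (Metric.infDist y Ωᶜ ^ (-β)) < ∞ := by
    calc ∫⁻ y in Ω, ∫⁻ x in Ω, ENNReal.ofReal (‖x - y‖ ^ (ε - 3))
        * ENNReal.ofReal (Metric.infDist y Ωᶜ ^ (-β))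
        ≤ ∫⁻ y in Ω, J * ENNReal.ofReal (Metric.infDist y Ωᶜ ^ (-β)) := by
          refine setLIntegral_mono' hΩ.measurableSet fun y hy => ?_
          rw [lintegral_mul_const' _ _ ENNReal.ofReal_ne_top]
          exact mul_le_mul_left (hJle y hy) _
      _ = J * ∫⁻ y in Ω, ENNReal.ofReal (Metric.infDist y Ωᶜ ^ (-β)) :=
          lintegral_const_mul' _ _ hJ.ne
      _ < ∞ := ENNReal.mul_lt_top hJ hI
  have h1 : ∫⁻ y in Ω, ∫⁻ x in Ω, ENNReal.ofReal (‖x - y‖ ^ (ε - 3))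
      * ENNReal.ofReal (Metric.infDist x Ωᶜ ^ (-β)) < ∞ := by
    -- The kernel `‖x - y‖ ^ (ε - 3)` is symmetric, so exchanging the variables reduces this term to
    -- `h2`.
    rw [lintegral_lintegral_swap]
    · simpa only [norm_sub_rev] using h2
    · refine Measurable.aemeasurable ?_
      exact Measurable.mul (by fun_prop) ((hmd.comp measurable_snd).pow_const _).ennreal_ofReal
  rw [lintegral_lintegral_add_left (f := fun q : E3 × E3 => ENNReal.ofReal (‖q.1 - q.2‖ ^ (ε - 3))
    * ENNReal.ofReal (Metric.infDist q.1 Ωᶜ ^ (-β)))]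
  · exact ENNReal.add_lt_top.2 ⟨h1, h2⟩
  · exact Measurable.mul (by fun_prop) ((hmd.comp measurable_fst).pow_const _).ennreal_ofReal

/-- The exit time of a positively curved convex domain has finite Slobodeckij energy of every order
less than one, with an explicit dependence on the speed. -/
lemma exists_lintegral_backTime_le {Ω : Set E3} (hΩ : IsPositivelyCurvedConvexDomain Ω) {ε : ℝ}
    (hε : ε ∈ Ioo (0 : ℝ) 1) : ∃ K : ℝ≥0∞, K < ∞ ∧ ∀ b : ℝ, ∀ v : E3, v ≠ 0 →
      ∫⁻ y in Ω, ∫⁻ x in Ω, ENNReal.ofReal (b ^ 2 * (backTime Ω v x - backTime Ω v y) ^ 2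
        / ‖x - y‖ ^ (3 + 2 * (1 - ε))) ≤ ENNReal.ofReal (b ^ 2 / ‖v‖ ^ 2) * K := by
  obtain ⟨κ, hκ, hround⟩ := hΩ.exists_ball_midpoint_subset
  have hlt := lintegral_singular_weights_lt_top hΩ.isOpen hΩ.convex hΩ.isBounded hε.1
    (sub_pos.2 hε.2) (by linarith [hε.1] : 1 - ε < 1)
  refine ⟨_, ENNReal.mul_lt_top (ENNReal.ofReal_lt_top (r := 2 / κ)) hlt, fun b v hv => ?_⟩
  have hv' : 0 < ‖v‖ := norm_pos_iff.2 hv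
  rw [← mul_assoc, ← ENNReal.ofReal_mul (by positivity),
    ← lintegral_const_mul' _ _ ENNReal.ofReal_ne_top]
  refine setLIntegral_mono' hΩ.isOpen.measurableSet fun y hy => ?_
  rw [← lintegral_const_mul' _ _ ENNReal.ofReal_ne_top]
  refine setLIntegral_mono' hΩ.isOpen.measurableSet fun x hx => ?_
  have hdx : 0 ≤ Metric.infDist x Ωᶜ ^ (-(1 - ε)) := Real.rpow_nonneg Metric.infDist_nonneg _
  have hdy : 0 ≤ Metric.infDist y Ωᶜ ^ (-(1 - ε)) := Real.rpow_nonneg Metric.infDist_nonneg _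
  rw [← ENNReal.ofReal_mul (by positivity), ← ENNReal.ofReal_mul (by positivity),
    ← ENNReal.ofReal_add (by positivity) (by positivity), ← ENNReal.ofReal_mul (by positivity)]
  apply ENNReal.ofReal_le_ofReal
  rcases eq_or_ne x y with rfl | hxy
  · simp only [sub_self, ne_eq, OfNat.ofNat_ne_zero, not_false_eq_true, zero_pow, mul_zero,
      zero_div]
    positivity
  have hz : 0 < ‖x - y‖ := norm_pos_iff.2 (sub_ne_zero.2 hxy)
  have h1 := sq_backTime_sub_le_rpow hΩ.isOpen hΩ.convex hΩ.isBounded hκ hround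
    (sub_pos.2 hε.2) (by linarith [hε.1] : 1 - ε < 1) hv hx hy
  rw [div_le_iff₀ (by positivity)]
  have h2 : ‖x - y‖ ^ (ε - 3) * ‖x - y‖ ^ (3 + 2 * (1 - ε)) = ‖x - y‖ ^ (1 + (1 - ε)) := by
    rw [← Real.rpow_add hz]
    ring_nf
  have h3 : (backTime Ω v x - backTime Ω v y) ^ 2
      ≤ 1 / ‖v‖ ^ 2 * (2 / κ) * (‖x - y‖ ^ (1 + (1 - ε))
        * (Metric.infDist x Ωᶜ ^ (-(1 - ε)) + Metric.infDist y Ωᶜ ^ (-(1 - ε)))) := by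
    have h4 : 0 < κ * ‖v‖ ^ 2 := by positivity
    rw [← mul_le_mul_iff_right₀ h4]
    refine h1.trans_eq ?_
    field_simp
  calc b ^ 2 * (backTime Ω v x - backTime Ω v y) ^ 2
      ≤ b ^ 2 * (1 / ‖v‖ ^ 2 * (2 / κ) * (‖x - y‖ ^ (1 + (1 - ε))
        * (Metric.infDist x Ωᶜ ^ (-(1 - ε)) + Metric.infDist y Ωᶜ ^ (-(1 - ε))))) := by gcongr
    _ = _ := by rw [← h2]; ring

end Kinetic

theorem mainTheorem8 (Ω : Set E3) (hΩ : IsPositivelyCurvedConvexDomain Ω)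
    (γ : ℝ) (hγ : γ ∈ Icc (0 : ℝ) 1)
    (B : ℝ → ℝ → ℝ) (hB : IsCutoffCrossSection γ B)
    (hν : ∃ ν₀ : ℝ, 0 < ν₀ ∧ ∀ v : E3, ν₀ * (1 + ‖v‖) ^ γ < collisionFrequency B v)
    (ε : ℝ) (hε : ε ∈ Ioo (0 : ℝ) 1)
    (h : E3 → E3 → ℝ) (hh : MemL2vHsx Ω (1 - ε) h)
    (hbound : ∃ a C : ℝ, 0 < a ∧ 0 < C ∧
      ∀ᵐ p : E3 × E3 ∂(volume.restrict (Ω ×ˢ univ)),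
        |h p.1 p.2| ≤ C * Real.exp (-a * ‖p.2‖ ^ 2)) :
    MemL2vHsx Ω (1 - ε) (transportSolution Ω (collisionFrequency B) h) := by
  obtain ⟨ν₀, hν₀, hνlt⟩ := hν
  obtain ⟨a, C, ha, hC, hbound⟩ := hbound
  have hνle : ∀ v, ν₀ ≤ collisionFrequency B v := fun v => by
    have h1 : 1 ≤ (1 + ‖v‖) ^ γ := Real.one_le_rpow (by linarith [norm_nonneg v]) hγ.1
    nlinarith [hνlt v]
  have hνpos : ∀ v, 0 < collisionFrequency B v := fun v => hν₀.trans_le (hνle v)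
  have hΩm := hΩ.isOpen.measurableSet
  have hms : MeasurableSet (Ω ×ˢ (univ : Set E3)) := hΩm.prod MeasurableSet.univ
  obtain ⟨k, hkm, hkb, hk0, hhk⟩ := exists_measurable_source hΩ.isOpen hh.memLp.1
    (b := fun v => C * Real.exp (-a * ‖v‖ ^ 2)) (by fun_prop) (fun v => by positivity) hbound
  have hkv : ∀ v, Measurable fun x => k x v := fun v =>
    hkm.comp (f := fun x : E3 => (x, v)) (by fun_prop)
  set T : E3 → E3 → ℝ := fun x v =>
    ∫ s in Ioi (0 : ℝ), Real.exp (-collisionFrequency B v * s) * k (x - s • v) v with hT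
  have hTm : Measurable fun p : E3 × E3 => T p.1 p.2 :=
    measurable_integral_Ioi (measurable_collisionFrequency hB.measurable) hkm
  have hTb : ∀ x v, |T x v| ≤ C * Real.exp (-a * ‖v‖ ^ 2) / ν₀ := fun x v =>
    (abs_integral_Ioi_le (hνpos v) fun s => hkb _ v).trans
      (div_le_div_of_nonneg_left (by positivity) hν₀ (hνle v))
  have hST : ∀ᵐ p : E3 × E3 ∂(volume.restrict (Ω ×ˢ univ)),
      transportSolution Ω (collisionFrequency B) h p.1 p.2 = T p.1 p.2 := by
    filter_upwards [transportSolution_congr_ae hΩ.isOpen hΩ.convex (collisionFrequency B) hhk,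
      ae_restrict_mem hms] with p h1 h2
    rw [h1, transportSolution_eq_integral_Ioi hΩ.isOpen hΩ.convex _ hk0 h2.1]
  have hsq : ∀ v : E3, (C * Real.exp (-a * ‖v‖ ^ 2)) ^ 2
      = C ^ 2 * Real.exp (-(2 * a) * ‖v‖ ^ 2) := fun v => by
    rw [mul_pow, ← Real.exp_nat_mul]
    congr 2
    push_cast
    ring
  constructor
  · refine MemLp.ae_eq (f := fun p : E3 × E3 => T p.1 p.2) (hST.mono fun p hp => hp.symm) ?_
    refine ⟨hTm.aestronglyMeasurable, ?_⟩
    rw [eLpNorm_lt_top_iff_lintegral_rpow_enorm_lt_top two_ne_zero ENNReal.ofNat_ne_top]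
    calc ∫⁻ p in Ω ×ˢ univ, ‖T p.1 p.2‖ₑ ^ (2 : ℝ≥0∞).toReal
        ≤ ∫⁻ p in Ω ×ˢ (univ : Set E3), ENNReal.ofReal (C ^ 2 / ν₀ ^ 2)
          * ENNReal.ofReal (Real.exp (-(2 * a) * ‖p.2‖ ^ 2)) := by
          refine lintegral_mono fun p => ?_
          rw [Real.enorm_eq_ofReal_abs, ENNReal.toReal_ofNat, ENNReal.rpow_two,
            ← ENNReal.ofReal_pow (abs_nonneg _), ← ENNReal.ofReal_mul (by positivity)]
          apply ENNReal.ofReal_le_ofReal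
          calc |T p.1 p.2| ^ 2 ≤ (C * Real.exp (-a * ‖p.2‖ ^ 2) / ν₀) ^ 2 := by
                gcongr
                exact hTb _ _
            _ = _ := by rw [div_pow, hsq]; ring
      _ = ENNReal.ofReal (C ^ 2 / ν₀ ^ 2)
          * (volume Ω * ∫⁻ v : E3, ENNReal.ofReal (Real.exp (-(2 * a) * ‖v‖ ^ 2))) := by
          rw [lintegral_const_mul' _ _ ENNReal.ofReal_ne_top, Measure.volume_eq_prod,
            ← Measure.prod_restrict, Measure.restrict_univ, lintegral_prod _ (by fun_prop)]
          simp only [lintegral_const, Measure.restrict_apply_univ]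
          rw [mul_comm (volume Ω)]
      _ < ∞ := ENNReal.mul_lt_top ENNReal.ofReal_lt_top (ENNReal.mul_lt_top
          hΩ.isBounded.measure_lt_top (lintegral_exp_sq_norm_lt_top (by positivity)))
  · have hEk : slobodeckijEnergy Ω (1 - ε) k < ∞ := by
      rw [← slobodeckijEnergy_congr_ae (1 - ε) hhk]
      exact hh.energy_lt_top
    rw [slobodeckijEnergy_congr_ae (1 - ε) hST]
    obtain ⟨K, hK, hKle⟩ := exists_lintegral_backTime_le hΩ hε
    set E : E3 → ℝ≥0∞ := fun v => ∫⁻ y in Ω, ∫⁻ x in Ω,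
      ENNReal.ofReal (|k x v - k y v| ^ 2 / ‖x - y‖ ^ (3 + 2 * (1 - ε))) with hE
    set M : ℝ≥0∞ := ENNReal.ofReal (1 / ν₀) with hM
    -- Of the two factors `M`, one comes from the Cauchy-Schwarz inequality and one from averaging
    -- over translations, each being the total mass `1/ν` of the exponential weight.
    have hfix : ∀ v : E3, v ≠ 0 → ∫⁻ y in Ω, ∫⁻ x in Ω,
        ENNReal.ofReal (|T x v - T y v| ^ 2 / ‖x - y‖ ^ (3 + 2 * (1 - ε)))
        ≤ 2 * (M * (M * E v)) + 2 * (ENNReal.ofReal (C ^ 2) * K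
          * ENNReal.ofReal (Real.exp (-(2 * a) * ‖v‖ ^ 2) / ‖v‖ ^ 2)) := by
      intro v hv
      have hn := hνpos v
      have hle : ENNReal.ofReal (1 / collisionFrequency B v) ≤ M :=
        ENNReal.ofReal_le_ofReal (one_div_le_one_div_of_le hν₀ (hνle v))
      have hGm := measurable_mul_energyKernel_translate hΩm (3 + 2 * (1 - ε)) (hkv v)
        (collisionFrequency B v) v
      have hGi : Measurable fun q : E3 × E3 => ENNReal.ofReal (1 / collisionFrequency B v)
          * ∫⁻ s in Ioi (0 : ℝ), ENNReal.ofReal (Real.exp (-collisionFrequency B v * s))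
            * energyKernel Ω (3 + 2 * (1 - ε)) (fun x => k x v) (q.1 - s • v, q.2 - s • v) :=
        hGm.lintegral_prod_right.const_mul _
      calc ∫⁻ y in Ω, ∫⁻ x in Ω,
            ENNReal.ofReal (|T x v - T y v| ^ 2 / ‖x - y‖ ^ (3 + 2 * (1 - ε)))
          ≤ ∫⁻ y in Ω, ∫⁻ x in Ω, (2 * (ENNReal.ofReal (1 / collisionFrequency B v)
            * ∫⁻ s in Ioi (0 : ℝ), ENNReal.ofReal (Real.exp (-collisionFrequency B v * s))
              * energyKernel Ω (3 + 2 * (1 - ε)) (fun x => k x v) (x - s • v, y - s • v))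
            + 2 * ENNReal.ofReal ((C * Real.exp (-a * ‖v‖ ^ 2)) ^ 2
              * (backTime Ω v x - backTime Ω v y) ^ 2 / ‖x - y‖ ^ (3 + 2 * (1 - ε)))) :=
            setLIntegral_mono' hΩm fun y hy => setLIntegral_mono' hΩm fun x hx =>
              energy_integrand_le hΩ.isOpen hΩ.convex hΩ.isBounded (hkv v) (fun x => hkb x v)
                (fun x hx => hk0 x v hx) hn _ hv hx hy
        _ = 2 * (ENNReal.ofReal (1 / collisionFrequency B v)
            * ∫⁻ y in Ω, ∫⁻ x in Ω, ∫⁻ s in Ioi (0 : ℝ),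
              ENNReal.ofReal (Real.exp (-collisionFrequency B v * s))
              * energyKernel Ω (3 + 2 * (1 - ε)) (fun x => k x v) (x - s • v, y - s • v))
            + 2 * ∫⁻ y in Ω, ∫⁻ x in Ω, ENNReal.ofReal ((C * Real.exp (-a * ‖v‖ ^ 2)) ^ 2
              * (backTime Ω v x - backTime Ω v y) ^ 2 / ‖x - y‖ ^ (3 + 2 * (1 - ε))) := by
            rw [lintegral_lintegral_add_left (hGi.const_mul 2)]
            simp only [lintegral_const_mul' _ _ ENNReal.ofNat_ne_top,
              lintegral_const_mul' _ _ ENNReal.ofReal_ne_top]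
        _ ≤ 2 * (M * (M * E v)) + 2 * (ENNReal.ofReal ((C * Real.exp (-a * ‖v‖ ^ 2)) ^ 2
              / ‖v‖ ^ 2) * K) := by
            gcongr
            · refine (lintegral_lintegral_energyKernel_translate_le hΩm _ (hkv v) hn v).trans ?_
              rw [lintegral_energyKernel hΩm _ (hkv v)]
              exact mul_le_mul_left hle _
            · exact hKle _ v hv
        _ = _ := by
            rw [hsq, mul_div_assoc, ENNReal.ofReal_mul (by positivity)]
            ring
    have hne : ∀ᵐ v : E3, v ≠ 0 := by
      simp [ae_iff]
    refine (lintegral_mono_ae (hne.mono hfix)).trans_lt ?_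
    rw [lintegral_add_right _ (by fun_prop)]
    simp only [lintegral_const_mul' _ _ ENNReal.ofNat_ne_top,
      lintegral_const_mul' M _ ENNReal.ofReal_ne_top,
      lintegral_const_mul' _ _ (ENNReal.mul_ne_top ENNReal.ofReal_ne_top hK.ne)]
    have hG := lintegral_exp_div_sq_norm_lt_top (by positivity : 0 < 2 * a)
    exact ENNReal.add_lt_top.2 ⟨ENNReal.mul_lt_top ENNReal.ofNat_lt_top (ENNReal.mul_lt_top
      ENNReal.ofReal_lt_top (ENNReal.mul_lt_top ENNReal.ofReal_lt_top hEk)),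
      ENNReal.mul_lt_top ENNReal.ofNat_lt_top (ENNReal.mul_lt_top
        (ENNReal.mul_lt_top ENNReal.ofReal_lt_top hK) hG)⟩
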